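/- **Setting.** Let $T\ge 2$, let $\mathcal X\subset\mathbb R^d$ be nonempty, closed and convex with $\|x-y\|\le D$ for all $x,y\in\mathcal X$, and let $f_1,\dots,f_T\colon\mathcal X\to\mathbb R$ be differentiable convex functions with $\|\nabla f_t(x)\|\le G$ for all $x\in\mathcal X$ and $t\le T$, where $G,D>0$. Let $\lambda>0$ and suppose that $(f_1,\dots,f_T)$ is $k$-contaminated $\lambda$-strongly convex: there is $I\subset\{1,\dots,T\}$ with $|I|=k$ such that for all $t\notin I$ and all $x,y\in\mathcal X$, $f_t(y)\ge f_t(x)+\langle\nabla f_t(x),y-x\rangle+\frac\lambda2\|x-y\|^2$. An online algorithm chooses $x_t\in\mathcal X$ before $f_t$ is revealed, and its regret is $R_T=\sum_{t=1}^Tf_t(x_t)-\min_{x\in\mathcal X}\sum_{t=1}^Tf_t(x)$. **Algorithms.** Fix a starting point $x_0\in\mathcal X$ (for instance $x_0=0$ if $0\in\mathcal X$). Put $m=\lceil\frac12\log_2T\rceil$ and, for $0\le i\le m$, $\eta_i=2^{-i}/(5GD)$ and $\rho_i=\big(1+\frac1{1+m}\big)/((i+1)(i+2))$. Write $\Pi^A_{\mathcal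 X}(y)=\operatorname{argmin}_{x\in\mathcal X}\langle A(y-x),y-x\rangle$ and $\Pi_{\mathcal X}=\Pi_{\mathcal X}^{I}$. Given the point $x_t$ played in round $t$, let $g_t=\nabla f_t(x_t)$ and $$\ell_t^\eta(u)=-\eta\langle g_t,x_t-u\rangle+\eta^2\langle g_t,x_t-u\rangle^2,\quad s_t^\eta(u)=-\eta\langle g_t,x_t-u\rangle+\eta^2G^2\|x_t-u\|^2,\quad c_t(u)=-\eta^c\langle g_t,x_t-u\rangle+(\eta^cGD)^2,$$ where $\eta^c=1/(2GD\sqrt T)$. *MetaGrad* (full version) plays $x_t=\sum_i\pi_t^i\eta_ix_t^i\big/\sum_i\pi_t^i\eta_i$, where $\pi_1^i=\rho_i$, $x_1^i=x_0$, $\pi_{t+1}^i=\pi_t^ie^{-\ell_t^{\eta_i}(x_t^i)}\big/\sum_j\pi_t^je^{-\ell_t^{\eta_j}(x_t^j)}$, and $x_{t+1}^i=\Pi_{\mathcal X}^{\Sigma^{-1}}\big(x_t^i-\Sigma\nabla\ell_t^{\eta_i}(x_t^i)\big)$ with $\Sigma=\Sigma_{t+1}^i=\big(D^{-2}I+2\eta_i^2\sum_{r\le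 t}g_rg_r^\top\big)^{-1}$. *Maler* has one convex expert $x_t^c$ with rate $\eta^c$ and initial weight $\frac13$ and, for each $i$, a strongly convex expert $x_t^{i,s}$ and an exp-concave expert $x_t^{i,\ell}$ with rate $\eta_i$ and initial weight $\rho_i/3$ each. All experts start at $x_0$, and Maler plays the average of the expert points weighted by (weight $\times$ rate). After round $t$ each weight is multiplied by $e^{-c_t(x_t^c)}$, $e^{-s_t^{\eta_i}(x_t^{i,s})}$, $e^{-\ell_t^{\eta_i}(x_t^{i,\ell})}$ respectively and divided by a common normalization (which does not affect the played points), and the points are updated by $x_{t+1}^c=\Pi_{\mathcal X}\big(x_t^c-\frac D{\eta^cG\sqrt t}\nabla c_t(x_t^c)\big)$, $x_{t+1}^{i,s}=\Pi_{\mathcal X}\big(x_t^{i,s}-\frac1{2\eta_i^2G^2t}\nabla s_t^{\eta_i}(x_t^{i,s})\big)$, and $x_{t+1}^{i,\ell}=\Pi_{\mathcal X}^{M}\big(x_t^{i,\ell}-2M^{-1}\nabla\ell_t^{\eta_i}(x_t^{i,\ell})\big)$ with $M=M_{t+1}^i=\frac4{D^2}I+\sum_{r\le t}\nabla\ell_r^{\eta_i}(x_r^{i,\ell})\nabla\ell_r^{\eta_i}(x_r^{i,\ell})^\top$.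 *USC* over a finite set $\mathcal E$ of expert algorithms with $|\mathcal E|\ge2$ runs every expert on $f_1,f_2,\dots$, giving points $x_t^i\in\mathcal X$, and plays $x_t=\sum_ip_t^ix_t^i$ with $p_t^i=\eta_{t-1}^iw_{t-1}^i\big/\sum_j\eta_{t-1}^jw_{t-1}^j$. Here, with $h_t^i=\frac{\langle\nabla f_t(x_t),x_t^i-x_t\rangle+GD}{2GD}$ and $r_t^i=\sum_jp_t^jh_t^j-h_t^i$, the weights and rates are those of Adapt-ML-Prod: $w_0^i=1/|\mathcal E|$, $\eta_t^i=\min\big\{\frac12,\sqrt{\log|\mathcal E|/(1+\sum_{\tau\le t}(r_\tau^i)^2)}\big\}$, $w_t^i=\big(w_{t-1}^i(1+\eta_{t-1}^ir_t^i)\big)^{\eta_t^i/\eta_{t-1}^i}$. **Statement.** There are an absolute constant $C$ and, for every $A$, a constant $C_A$ depending only on $A$, such that in every such setting (all $d,T,k,\mathcal X,x_0,G,D,\lambda,f_1,\dots,f_T$) the three algorithms play points of $\mathcal X$ and: 1. MetaGrad satisfies $R_T\le C\Big(\big(\frac{G^2}\lambda+GD\big)\,d\log T+GD\sqrt{k\,d\log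 T}\Big)$; 2. Maler satisfies $R_T\le C\Big(\big(\frac{G^2}\lambda+GD\big)\log T+GD\sqrt{k\log T}\Big)$; 3. USC over any $\mathcal E$ with $2\le|\mathcal E|\le A\log T$ that contains Maler satisfies $R_T\le C_A\Big(\big(\frac{G^2}\lambda+GD\big)\log T+GD\sqrt{k\log T}\Big)$. -/

import Mathlib

noncomputable section

namespace OCO

/-- The space `ℝ^d` with the Euclidean norm. -/
abbrev Vec (d : ℕ) : Type := EuclideanSpace ℝ (Fin d)

/-! ### Losses, instances, contamination -/

/-- A loss `f` together with its gradient map `∇f`; only their values on the decision set matter. -/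
structure Loss (d : ℕ) where
  val : Vec d → ℝ
  grad : Vec d → Vec d

/-- `f` is a differentiable convex function on `X` whose gradient at the points of `X` is
`f.grad` (the gradient is taken relative to `X`, since `f` is only a function on `X`). -/
def Loss.IsConvexDiff {d : ℕ} (X : Set (Vec d)) (f : Loss d) : Prop :=
  ConvexOn ℝ X f.val ∧ ∀ x ∈ X, HasGradientWithinAt f.val (f.grad x) X x

/-- `lam`-strong convexity on `X`. -/
def Loss.IsStronglyConvex {d : ℕ} (X : Set (Vec d)) (lam : ℝ) (f : Loss d) : Prop :=
  ∀ x ∈ X, ∀ y ∈ X,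
    f.val x + inner ℝ (f.grad x) (y - x) + lam / 2 * ‖x - y‖ ^ 2 ≤ f.val y

/-- The first `T` losses belong to `k`-contaminated `F`. Rounds are numbered `0, …, T - 1`. -/
def IsContaminated {d : ℕ} (T k : ℕ) (F : Loss d → Prop) (f : ℕ → Loss d) : Prop :=
  ∃ I : Finset ℕ, I ⊆ Finset.range T ∧ I.card = k ∧ ∀ t ∈ Finset.range T \ I, F (f t)

/-- The standing assumptions on an online convex optimization instance with `T` rounds:
decision set `X` of diameter at most `D`, differentiable convex losses, gradients at most `G`. -/
structure IsInstance {d : ℕ} (X : Set (Vec d)) (G D : ℝ) (T : ℕ) (f : ℕ → Loss d) : Prop where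
  convex : Convex ℝ X
  closed : IsClosed X
  D_pos : 0 < D
  diam_le : ∀ x ∈ X, ∀ y ∈ X, ‖x - y‖ ≤ D
  loss : ∀ t < T, (f t).IsConvexDiff X
  G_pos : 0 < G
  grad_le : ∀ t < T, ∀ x ∈ X, ‖(f t).grad x‖ ≤ G

/-! ### Online algorithms and regret -/

/-- A deterministic online algorithm: in each round it plays a point determined by its current
state, then the loss of the round is revealed and the state is updated. -/
structure OnlineAlgorithm (d : ℕ) where
  State : Type
  init : State
  play : State → Vec d
  update : State → Loss d → State

/-- The state before round `t`. -/
def OnlineAlgorithm.state {d : ℕ} (A : OnlineAlgorithm d) (f : ℕ → Loss d) : ℕ → A.State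
  | 0 => A.init
  | t + 1 => A.update (A.state f t) (f t)

/-- The point played in round `t`. -/
def OnlineAlgorithm.action {d : ℕ} (A : OnlineAlgorithm d) (f : ℕ → Loss d) (t : ℕ) : Vec d :=
  A.play (A.state f t)

/-- `R_T = ∑ f_t(x_t) - min_{x ∈ X} ∑ f_t(x)`. For continuous losses and compact nonempty `X`
the infimum is the minimum. -/
def OnlineAlgorithm.regret {d : ℕ} (A : OnlineAlgorithm d) (X : Set (Vec d)) (f : ℕ → Loss d)
    (T : ℕ) : ℝ :=
  ∑ t ∈ Finset.range T, (f t).val (A.action f t)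
    - sInf ((fun x : Vec d => ∑ t ∈ Finset.range T, (f t).val x) '' X)

/-! ### Matrices and projections -/

/-- The matrix-vector product `A v`. -/
def mulV {d : ℕ} (A : Matrix (Fin d) (Fin d) ℝ) (v : Vec d) : Vec d :=
  WithLp.toLp 2 (A.mulVec v.ofLp)

/-- The rank-one matrix `v vᵀ`. -/
def outer {d : ℕ} (v : Vec d) : Matrix (Fin d) (Fin d) ℝ :=
  Matrix.vecMulVec v.ofLp v.ofLp

/-- `‖v‖_A² = ⟨A v, v⟩`. -/
def normSqOf {d : ℕ} (A : Matrix (Fin d) (Fin d) ℝ) (v : Vec d) : ℝ :=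
  inner ℝ (mulV A v) v

/-- `Π_X^A(y) = argmin_{x ∈ X} ‖y - x‖_A²` (unique for `X` nonempty, closed and convex and `A`
positive definite). -/
def projOf {d : ℕ} (X : Set (Vec d)) (A : Matrix (Fin d) (Fin d) ℝ) (y : Vec d) : Vec d :=
  Classical.epsilon fun x => x ∈ X ∧ ∀ z ∈ X, normSqOf A (y - x) ≤ normSqOf A (y - z)

/-- The Euclidean projection `Π_X(y) = argmin_{x ∈ X} ‖y - x‖²`. -/
def proj {d : ℕ} (X : Set (Vec d)) (y : Vec d) : Vec d :=
  Classical.epsilon fun x => x ∈ X ∧ ∀ z ∈ X, ‖y - x‖ ^ 2 ≤ ‖y - z‖ ^ 2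

/-! ### The grid of learning rates of MetaGrad and Maler -/

/-- `⌈(1/2) log₂ T⌉`, the index of the last grid point. -/
def gridTop (T : ℕ) : ℕ := ⌈(1 / 2 : ℝ) * Real.logb 2 (T : ℝ)⌉₊

/-- The indices `0, 1, …, ⌈(1/2) log₂ T⌉`. -/
def gridIdx (T : ℕ) : Finset ℕ := Finset.range (gridTop T + 1)

/-- `η_i = 2^{-i} / (5 G D)`. -/
def gridRate (G D : ℝ) (i : ℕ) : ℝ := (2 : ℝ)⁻¹ ^ i / (5 * G * D)

/-- `C / ((i + 1)(i + 2))` with `C = 1 + 1 / (1 + ⌈(1/2) log₂ T⌉)`. -/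
def gridPrior (T : ℕ) (i : ℕ) : ℝ :=
  (1 + 1 / (1 + (gridTop T : ℝ))) / (((i : ℝ) + 1) * ((i : ℝ) + 2))

/-! ### Surrogate losses. Here `x` is the point played by the master and `g = ∇f_t(x)`. -/

/-- `ℓ_t^η(u) = -η ⟨g, x - u⟩ + η² ⟨g, x - u⟩²`. -/
def lLoss {d : ℕ} (η : ℝ) (x g u : Vec d) : ℝ :=
  -η * inner ℝ g (x - u) + η ^ 2 * (inner ℝ g (x - u)) ^ 2

/-- The gradient of `ℓ_t^η` at `u`. -/
def lGrad {d : ℕ} (η : ℝ) (x g u : Vec d) : Vec d :=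
  (η * (1 + 2 * η * inner ℝ g (u - x))) • g

/-- `s_t^η(u) = -η ⟨g, x - u⟩ + η² G² ‖x - u‖²`. -/
def sLoss {d : ℕ} (G η : ℝ) (x g u : Vec d) : ℝ :=
  -η * inner ℝ g (x - u) + η ^ 2 * G ^ 2 * ‖x - u‖ ^ 2

/-- The gradient of `s_t^η` at `u`. -/
def sGrad {d : ℕ} (G η : ℝ) (x g u : Vec d) : Vec d :=
  η • g + (2 * η ^ 2 * G ^ 2) • (u - x)

/-- `c_t(u) = -η ⟨g, x - u⟩ + (η G D)²`. -/
def cLoss {d : ℕ} (G D η : ℝ) (x g u : Vec d) : ℝ :=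
  -η * inner ℝ g (x - u) + (η * G * D) ^ 2

/-- The gradient of `c_t` (at every point). -/
def cGrad {d : ℕ} (η : ℝ) (g : Vec d) : Vec d := η • g

/-! ### MetaGrad (full version) -/

/-- Weights `π_t^{η_i}` and points `x_t^{η_i}` of the slaves, and the matrix
`∑_{s < t} ∇f_s(x_s) ∇f_s(x_s)ᵀ`. Only the indices in the grid are used. -/
structure MetaGradState (d : ℕ) where
  weight : ℕ → ℝ
  pt : ℕ → Vec d
  gram : Matrix (Fin d) (Fin d) ℝ

/-- The master's prediction `∑ π_t^{η_i} η_i x_t^{η_i} / ∑ π_t^{η_i} η_i`. -/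
def metaGradPlay {d : ℕ} (G D : ℝ) (T : ℕ) (s : MetaGradState d) : Vec d :=
  (∑ i ∈ gridIdx T, s.weight i * gridRate G D i)⁻¹ •
    ∑ i ∈ gridIdx T, (s.weight i * gridRate G D i) • s.pt i

/-- The matrix `Σ^η = (D⁻² I + 2 η² S)⁻¹` of a slave, where `S` is the sum of the `∇f ∇fᵀ`. -/
def metaGradSigma {d : ℕ} (D η : ℝ) (S : Matrix (Fin d) (Fin d) ℝ) :
    Matrix (Fin d) (Fin d) ℝ :=
  ((1 / D ^ 2) • (1 : Matrix (Fin d) (Fin d) ℝ) + (2 * η ^ 2) • S)⁻¹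

/-- One round of MetaGrad with gradient `g` at the played point `x`: exponential weights update
of the master and the projected Newton step of the slaves. -/
def metaGradStep {d : ℕ} (X : Set (Vec d)) (G D : ℝ) (T : ℕ) (s : MetaGradState d)
    (x g : Vec d) : MetaGradState d where
  weight i :=
    s.weight i * Real.exp (-lLoss (gridRate G D i) x g (s.pt i)) /
      ∑ j ∈ gridIdx T, s.weight j * Real.exp (-lLoss (gridRate G D j) x g (s.pt j))
  pt i :=
    projOf X (metaGradSigma D (gridRate G D i) (s.gram + outer g))⁻¹
      (s.pt i - mulV (metaGradSigma D (gridRate G D i) (s.gram + outer g))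
        (lGrad (gridRate G D i) x g (s.pt i)))
  gram := s.gram + outer g

/-- MetaGrad on `X` with parameters `G`, `D`, `T`, started at `x₀`. -/
def metaGrad {d : ℕ} (X : Set (Vec d)) (x₀ : Vec d) (G D : ℝ) (T : ℕ) : OnlineAlgorithm d where
  State := MetaGradState d
  init := { weight := gridPrior T, pt := fun _ => x₀, gram := 0 }
  play := metaGradPlay G D T
  update s f :=
    metaGradStep X G D T s (metaGradPlay G D T s) (f.grad (metaGradPlay G D T s))

/-! ### Maler -/

/-- The state of Maler: the number `round` of the current round (starting at `1`) and, for the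
convex expert (suffix `C`), the strongly convex experts (suffix `S`, one for each grid point) and
the exp-concave experts (suffix `L`, one for each grid point), the weights `π_t`, the cumulative
surrogate losses of the past rounds, the points, and the matrices of the exp-concave experts. -/
structure MalerState (d : ℕ) where
  round : ℕ
  wC : ℝ
  wS : ℕ → ℝ
  wL : ℕ → ℝ
  cumC : ℝ
  cumS : ℕ → ℝ
  cumL : ℕ → ℝ
  ptC : Vec d
  ptS : ℕ → Vec d
  ptL : ℕ → Vec d
  matL : ℕ → Matrix (Fin d) (Fin d) ℝ

/-- `η^c = 1 / (2 G D √T)`. -/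
def malerRateC (G D : ℝ) (T : ℕ) : ℝ := 1 / (2 * G * D * √(T : ℝ))

/-- The point played by Maler, the tilted weighted average of the points of all experts. -/
def malerPlay {d : ℕ} (G D : ℝ) (T : ℕ) (s : MalerState d) : Vec d :=
  (s.wC * malerRateC G D T +
      ∑ i ∈ gridIdx T, (s.wS i * gridRate G D i + s.wL i * gridRate G D i))⁻¹ •
    ((s.wC * malerRateC G D T) • s.ptC +
      ∑ i ∈ gridIdx T,
        ((s.wS i * gridRate G D i) • s.ptS i + (s.wL i * gridRate G D i) • s.ptL i))

/-- The normalization `Φ_t`, as a function of the cumulative surrogate losses up to round `t`. -/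
def malerPhi (T : ℕ) (cumC : ℝ) (cumS cumL : ℕ → ℝ) : ℝ :=
  ∑ i ∈ gridIdx T,
      (gridPrior T i / 3 * Real.exp (-cumS i) + gridPrior T i / 3 * Real.exp (-cumL i)) +
    1 / 3 * Real.exp (-cumC)

/-- One round of Maler with gradient `g` at the played point `x`. -/
def malerStep {d : ℕ} (X : Set (Vec d)) (G D : ℝ) (T : ℕ) (s : MalerState d)
    (x g : Vec d) : MalerState d :=
  let lossC : ℝ := cLoss G D (malerRateC G D T) x g s.ptC
  let lossS : ℕ → ℝ := fun i => sLoss G (gridRate G D i) x g (s.ptS i)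
  let lossL : ℕ → ℝ := fun i => lLoss (gridRate G D i) x g (s.ptL i)
  let Φ : ℝ := malerPhi T (s.cumC + lossC) (fun i => s.cumS i + lossS i)
    (fun i => s.cumL i + lossL i)
  let gradL : ℕ → Vec d := fun i => lGrad (gridRate G D i) x g (s.ptL i)
  let M : ℕ → Matrix (Fin d) (Fin d) ℝ := fun i => s.matL i + outer (gradL i)
  let β : ℝ := 1 / 2
  { round := s.round + 1
    wC := s.wC * Real.exp (-lossC) / Φ
    wS := fun i => s.wS i * Real.exp (-lossS i) / Φ
    wL := fun i => s.wL i * Real.exp (-lossL i) / Φ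
    cumC := s.cumC + lossC
    cumS := fun i => s.cumS i + lossS i
    cumL := fun i => s.cumL i + lossL i
    ptC := proj X (s.ptC -
      (D / (malerRateC G D T * G * √(s.round : ℝ))) • cGrad (malerRateC G D T) g)
    ptS := fun i => proj X (s.ptS i -
      (1 / (2 * gridRate G D i ^ 2 * G ^ 2 * (s.round : ℝ))) •
        sGrad G (gridRate G D i) x g (s.ptS i))
    ptL := fun i => projOf X (M i) (s.ptL i - (1 / β) • mulV (M i)⁻¹ (gradL i))
    matL := M }

/-- Maler on `X` with parameters `G`, `D`, `T`, all experts started at `x₀`. The matrices of the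
exp-concave experts start at `(1 / (β² D²)) I` with `β = 1 / 2`. -/
def maler {d : ℕ} (X : Set (Vec d)) (x₀ : Vec d) (G D : ℝ) (T : ℕ) : OnlineAlgorithm d where
  State := MalerState d
  init :=
    { round := 1
      wC := 1 / 3
      wS := fun i => gridPrior T i / 3
      wL := fun i => gridPrior T i / 3
      cumC := 0
      cumS := fun _ => 0
      cumL := fun _ => 0
      ptC := x₀
      ptS := fun _ => x₀
      ptL := fun _ => x₀
      matL := fun _ => (1 / ((1 / 2 : ℝ) ^ 2 * D ^ 2)) • (1 : Matrix (Fin d) (Fin d) ℝ) }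
  play := malerPlay G D T
  update s f := malerStep X G D T s (malerPlay G D T s) (f.grad (malerPlay G D T s))

/-! ### USC: Adapt-ML-Prod over a finite family of experts -/

/-- The current states of the experts, the weights `w_{t-1}^i`, and the sums
`∑_{s ≤ t-1} (ℓ_s - ℓ_s^i)²`. -/
structure USCState {d : ℕ} {ι : Type} (experts : ι → OnlineAlgorithm d) where
  expert : ∀ i, (experts i).State
  w : ι → ℝ
  sq : ι → ℝ

/-- `η^i = min {1/2, √(log |𝓔| / (1 + ∑ (ℓ_s - ℓ_s^i)²))}`, with `K = |𝓔|` and `v` the sum. -/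
def uscRate (K : ℕ) (v : ℝ) : ℝ := min (1 / 2) √(Real.log (K : ℝ) / (1 + v))

/-- The weight `p_t^i = η_{t-1}^i w_{t-1}^i / ∑_j η_{t-1}^j w_{t-1}^j`. -/
def uscProb {d : ℕ} {ι : Type} [Fintype ι] {experts : ι → OnlineAlgorithm d}
    (s : USCState experts) (i : ι) : ℝ :=
  uscRate (Fintype.card ι) (s.sq i) * s.w i /
    ∑ j, uscRate (Fintype.card ι) (s.sq j) * s.w j

/-- The point `x_t = ∑ p_t^i x_t^i`. -/
def uscPlay {d : ℕ} {ι : Type} [Fintype ι] {experts : ι → OnlineAlgorithm d}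
    (s : USCState experts) : Vec d :=
  ∑ i, uscProb s i • (experts i).play (s.expert i)

/-- The normalized linearized loss `ℓ_t^i = (⟨∇f_t(x_t), x_t^i - x_t⟩ + G D) / (2 G D)`. -/
def uscLoss {d : ℕ} {ι : Type} [Fintype ι] {experts : ι → OnlineAlgorithm d} (G D : ℝ)
    (s : USCState experts) (f : Loss d) (i : ι) : ℝ :=
  (inner ℝ (f.grad (uscPlay s)) ((experts i).play (s.expert i) - uscPlay s) + G * D) /
    (2 * G * D)

/-- `ℓ_t - ℓ_t^i`, where `ℓ_t = ∑_j p_t^j ℓ_t^j`. -/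
def uscGap {d : ℕ} {ι : Type} [Fintype ι] {experts : ι → OnlineAlgorithm d} (G D : ℝ)
    (s : USCState experts) (f : Loss d) (i : ι) : ℝ :=
  (∑ j, uscProb s j * uscLoss G D s f j) - uscLoss G D s f i

/-- USC over the given experts with parameters `G`, `D`. The revealed loss is passed on to every
expert; the weights follow
`w_t^i = (w_{t-1}^i (1 + η_{t-1}^i (ℓ_t - ℓ_t^i))) ^ (η_t^i / η_{t-1}^i)`, `w_0^i = 1 / |𝓔|`. -/
def usc {d : ℕ} {ι : Type} [Fintype ι] (experts : ι → OnlineAlgorithm d) (G D : ℝ) :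
    OnlineAlgorithm d where
  State := USCState experts
  init :=
    { expert := fun i => (experts i).init
      w := fun _ => 1 / (Fintype.card ι : ℝ)
      sq := fun _ => 0 }
  play := uscPlay
  update s f :=
    { expert := fun i => (experts i).update (s.expert i) f
      w := fun i =>
        (s.w i * (1 + uscRate (Fintype.card ι) (s.sq i) * uscGap G D s f i)) ^
          (uscRate (Fintype.card ι) (s.sq i + uscGap G D s f i ^ 2) /
            uscRate (Fintype.card ι) (s.sq i))
      sq := fun i => s.sq i + uscGap G D s f i ^ 2 }

/-- The bound `(G²/λ + G D) d' log T + G D √(k d' log T)`. -/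
def regretBound (G D lam : ℝ) (k T : ℕ) (d' : ℝ) : ℝ :=
  (G ^ 2 / lam + G * D) * d' * Real.log (T : ℝ) +
    G * D * √((k : ℝ) * d' * Real.log (T : ℝ))

end OCO

end

/-!
All three bounds come from one principle: a second-order bound on the linearized regret,
`∑ ⟪g_t, x_t - u⟫ ≤ a √(B W) + b G D B` with `W = ∑ G² ‖x_t - u‖²`, adapts to contamination by
itself (`sum_sub_le_of_second_order`). An uncontaminated round gives back `λ/2 ‖x_t - u‖²`, which
absorbs its share of `√(B W)` by the inequality of arithmetic and geometric means at the price
`G² B / λ`; a contaminated round adds at most `G² D²` to `W`, whence the term `G D √(k B)`. Here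
`B = d log T` for MetaGrad and `B = log T` for Maler and USC.

For MetaGrad and Maler the second-order bound has two halves. Since the master plays the mean of
its experts tilted by the learning rates, and `exp (z - z²) ≤ 1 + z`, the sum of the unnormalized
weights never grows (`sum_mul_exp_neg_le_of_tiltedMean`), so that each expert's cumulative surrogate
loss is at least the logarithm of its prior, hence at least `-O(log T)`. An expert's own regret on
its surrogate loss is also small. For MetaGrad it is a log-determinant, bounded by the
telescoping of projected Newton steps (`two_mul_lLoss_sub_le`, `log_det_newtonMat_sub_le`). For
Maler the strongly convex experts suffice (`sLoss_sub_le`); of the other experts one only needs that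
their points stay in `X` and that they do not raise the potential. Together,
`η r ≤ η² V + O(B)` for every rate `η` of the grid, where `r` is the linearized regret and `V` is at
most `W`; the best rate of the grid gives the bound (`le_of_forall_gridRate`).

USC is compared with the moving points of its expert Maler. The second-order bound of Adapt-ML-Prod
(`adaptMLProd_sum_le`) has only factors of order `log (log T)` when there are `O(log T)` experts,
so that the same principle applies, with Maler's points as comparators and `B = log T`; the regret
of Maler itself is then added.
-/

namespace OCO

variable {d : ℕ} {X : Set (Vec d)}

/-! ### First-order inequalities and projections -/

/-- The first-order inequality for a convex function, with a gradient taken relative to `X`. -/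
lemma Loss.IsConvexDiff.le_add_inner {f : Loss d} (hf : f.IsConvexDiff X) {x y : Vec d}
    (hx : x ∈ X) (hy : y ∈ X) : f.val x + inner ℝ (f.grad x) (y - x) ≤ f.val y := by
  have hseg : ∀ s ∈ Set.Icc (0 : ℝ) 1, x + s • (y - x) ∈ X := fun s hs =>
    hf.1.1.add_smul_sub_mem hx hy hs
  have hderiv : HasDerivWithinAt (fun s : ℝ => f.val (x + s • (y - x)))
      (inner ℝ (f.grad x) (y - x)) (Set.Icc 0 1) 0 := by
    have h1 : HasDerivWithinAt (fun s : ℝ => x + s • (y - x)) (y - x) (Set.Icc 0 1) 0 := by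
      simpa using (((hasDerivAt_id (0 : ℝ)).smul_const (y - x)).const_add x).hasDerivWithinAt
    have h2 : HasFDerivWithinAt f.val (InnerProductSpace.toDual ℝ (Vec d) (f.grad x)) X
        (x + (0 : ℝ) • (y - x)) := by
      simpa using (hf.2 x hx).hasFDerivWithinAt
    have h3 := h2.comp_hasDerivWithinAt (0 : ℝ) h1 (fun s hs => hseg s hs)
    simpa [Function.comp_def] using h3
  have hslope := hasDerivWithinAt_iff_tendsto_slope.1 hderiv
  have hne : (nhdsWithin (0 : ℝ) (Set.Icc 0 1 \ {0})).NeBot := by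
    rw [Set.Icc_sdiff_left]
    exact mem_closure_iff_nhdsWithin_neBot.1
      (by rw [closure_Ioc (by norm_num)]; simp)
  have hle : inner ℝ (f.grad x) (y - x) ≤ f.val y - f.val x := by
    refine le_of_tendsto hslope ?_
    filter_upwards [self_mem_nhdsWithin] with s hs
    have hs0 : 0 < s := lt_of_le_of_ne hs.1.1 (Ne.symm hs.2)
    have hc := hf.1.2 hx hy (sub_nonneg.2 hs.1.2) hs0.le (by ring)
    have he : (1 - s) • x + s • y = x + s • (y - x) := by module
    rw [he, smul_eq_mul, smul_eq_mul] at hc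
    rw [slope_def_field, div_le_iff₀ (by simpa using hs0)]
    simp only [zero_smul, add_zero, sub_zero]
    linarith
  linarith

lemma mulV_eq (A : Matrix (Fin d) (Fin d) ℝ) (v : Vec d) :
    mulV A v = Matrix.toEuclideanLin A v := rfl

lemma mulV_sub (A : Matrix (Fin d) (Fin d) ℝ) (v w : Vec d) :
    mulV A (v - w) = mulV A v - mulV A w := by simp [mulV_eq]

lemma mulV_smul (A : Matrix (Fin d) (Fin d) ℝ) (c : ℝ) (v : Vec d) :
    mulV A (c • v) = c • mulV A v := by simp [mulV_eq]

lemma mulV_mulV (A B : Matrix (Fin d) (Fin d) ℝ) (v : Vec d) :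
    mulV A (mulV B v) = mulV (A * B) v := by
  simp [mulV, Matrix.mulVec_mulVec]

lemma mulV_one (v : Vec d) : mulV 1 v = v := by
  simp [mulV]

lemma mulV_add_mat (A B : Matrix (Fin d) (Fin d) ℝ) (v : Vec d) :
    mulV (A + B) v = mulV A v + mulV B v := by simp [mulV_eq]

lemma mulV_smul_mat (c : ℝ) (A : Matrix (Fin d) (Fin d) ℝ) (v : Vec d) :
    mulV (c • A) v = c • mulV A v := by simp [mulV_eq]

lemma mulV_outer (g v : Vec d) : mulV (outer g) v = (inner ℝ g v : ℝ) • g := by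
  ext i
  simp [mulV, outer, Matrix.mulVec, dotProduct, Matrix.vecMulVec_apply, PiLp.inner_apply,
    Finset.sum_mul]
  exact Finset.sum_congr rfl fun j _ => by ring

lemma continuous_mulV (A : Matrix (Fin d) (Fin d) ℝ) : Continuous (mulV A) :=
  (Matrix.toEuclideanLin A).continuous_of_finiteDimensional

lemma inner_mulV_comm {A : Matrix (Fin d) (Fin d) ℝ} (hA : A.IsHermitian) (v w : Vec d) :
    (inner ℝ (mulV A v) w : ℝ) = inner ℝ (mulV A w) v := by
  rw [real_inner_comm v]
  exact (Matrix.isSymmetric_toEuclideanLin_iff.2 hA) v w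

lemma normSqOf_sub {A : Matrix (Fin d) (Fin d) ℝ} (hA : A.IsHermitian) (v w : Vec d) :
    normSqOf A (v - w) = normSqOf A v - 2 * inner ℝ (mulV A v) w + normSqOf A w := by
  have := inner_mulV_comm hA v w
  simp only [normSqOf, mulV_sub, inner_sub_left, inner_sub_right]
  linarith

lemma normSqOf_smul (A : Matrix (Fin d) (Fin d) ℝ) (c : ℝ) (v : Vec d) :
    normSqOf A (c • v) = c ^ 2 * normSqOf A v := by
  simp only [normSqOf, mulV_smul, real_inner_smul_left, real_inner_smul_right]
  ring

lemma normSqOf_nonneg {A : Matrix (Fin d) (Fin d) ℝ} (hA : A.PosSemidef) (v : Vec d) :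
    0 ≤ normSqOf A v := by
  have := hA.dotProduct_mulVec_nonneg v.ofLp
  simpa [normSqOf, mulV, EuclideanSpace.inner_eq_star_dotProduct] using this

lemma normSqOf_one (v : Vec d) : normSqOf 1 v = ‖v‖ ^ 2 := by
  rw [normSqOf, mulV_one, real_inner_self_eq_norm_sq]

/-- On a compact set the minimum defining the projection is attained, for every matrix. -/
lemma projOf_spec (hX : IsCompact X) (hne : X.Nonempty) (A : Matrix (Fin d) (Fin d) ℝ)
    (y : Vec d) : projOf X A y ∈ X ∧
      ∀ z ∈ X, normSqOf A (y - projOf X A y) ≤ normSqOf A (y - z) := by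
  have hcont : ContinuousOn (fun z => normSqOf A (y - z)) X := by
    have := continuous_mulV A
    unfold normSqOf
    fun_prop
  obtain ⟨x, hx, hmin⟩ := hX.exists_isMinOn hne hcont
  exact Classical.epsilon_spec
    (p := fun x => x ∈ X ∧ ∀ z ∈ X, normSqOf A (y - x) ≤ normSqOf A (y - z))
    ⟨x, hx, fun z hz => hmin hz⟩

/-- Projecting onto a convex set in the norm of `A` does not increase the `A`-distance to the
points of the set. -/
lemma normSqOf_projOf_sub_le (hX : IsCompact X) (hc : Convex ℝ X)
    {A : Matrix (Fin d) (Fin d) ℝ} (hA : A.PosSemidef) (y : Vec d) {z : Vec d} (hz : z ∈ X) :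
    normSqOf A (projOf X A y - z) ≤ normSqOf A (y - z) := by
  obtain ⟨hp, hmin⟩ := projOf_spec hX ⟨z, hz⟩ A y
  set p := projOf X A y
  -- The minimality of `p` along the segment from `p` to `z`, for every step size `s`.
  have hvar : ∀ s : ℝ, 0 < s → s ≤ 1 →
      2 * inner ℝ (mulV A (y - p)) (z - p) ≤ s * normSqOf A (z - p) := by
    intro s hs hs1
    have h := hmin _ (hc.add_smul_sub_mem hp hz ⟨hs.le, hs1⟩)
    have he : y - (p + s • (z - p)) = (y - p) - s • (z - p) := by abel
    rw [he, normSqOf_sub hA.1 (y - p), normSqOf_smul, real_inner_smul_right] at h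
    nlinarith
  have hfirst : inner ℝ (mulV A (y - p)) (z - p) ≤ (0 : ℝ) := by
    by_contra! hpos
    have hq := normSqOf_nonneg hA (z - p)
    have h1 := hvar 1 one_pos le_rfl
    have hq0 : 0 < normSqOf A (z - p) := by linarith
    have := hvar (inner ℝ (mulV A (y - p)) (z - p) / normSqOf A (z - p)) (by positivity)
      ((div_le_one hq0).2 (by linarith))
    rw [div_mul_cancel₀ _ hq0.ne'] at this
    linarith
  have he : y - z = (y - p) - (z - p) := by abel
  have he' : normSqOf A (p - z) = normSqOf A (z - p) := by
    have := normSqOf_smul A (-1) (z - p)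
    rw [show (-1 : ℝ) • (z - p) = p - z by module] at this
    linarith
  rw [he', he, normSqOf_sub hA.1 (y - p)]
  linarith [normSqOf_nonneg hA (y - p)]

lemma proj_eq_projOf (y : Vec d) : proj X y = projOf X 1 y := by
  simp only [proj, projOf, normSqOf_one]

lemma proj_mem (hX : IsCompact X) (hne : X.Nonempty) (y : Vec d) : proj X y ∈ X := by
  rw [proj_eq_projOf]
  exact (projOf_spec hX hne 1 y).1

lemma norm_proj_sub_sq_le (hX : IsCompact X) (hc : Convex ℝ X) (y : Vec d) {z : Vec d}
    (hz : z ∈ X) : ‖proj X y - z‖ ^ 2 ≤ ‖y - z‖ ^ 2 := by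
  have := normSqOf_projOf_sub_le hX hc Matrix.PosSemidef.one y hz
  rwa [normSqOf_one, normSqOf_one, ← proj_eq_projOf] at this

lemma IsInstance.isCompact {G D : ℝ} {T : ℕ} {f : ℕ → Loss d} (h : IsInstance X G D T f) :
    IsCompact X := by
  refine Metric.isCompact_of_isClosed_isBounded h.closed ?_
  exact Metric.isBounded_iff.2 ⟨D, fun x hx y hy => by
    rw [dist_eq_norm]; exact h.diam_le x hx y hy⟩

/-! ### Tilted exponential weights -/

lemma exp_sub_sq_le {z : ℝ} (hz : -(1 / 2) ≤ z) : Real.exp (z - z ^ 2) ≤ 1 + z := by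
  rcases le_total 0 z with h | h
  · rw [← Real.le_log_iff_exp_le (by linarith)]
    refine le_trans ?_ (Real.le_log_one_add_of_nonneg h)
    rw [le_div_iff₀ (by linarith)]
    nlinarith [pow_nonneg h 2, pow_nonneg h 3]
  · have hy : 0 ≤ -(z - z ^ 2) := by nlinarith [sq_nonneg z]
    have hq := Real.quadratic_le_exp_of_nonneg hy
    rw [Real.exp_neg] at hq
    have hpos := Real.exp_pos (z - z ^ 2)
    have hprod : 1 ≤ (1 + z) * (1 + -(z - z ^ 2) + (-(z - z ^ 2)) ^ 2 / 2) := by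
      have : (1 + z) * (1 + -(z - z ^ 2) + (-(z - z ^ 2)) ^ 2 / 2) - 1
          = z ^ 2 * (1 + z * (1 - z) + z ^ 3) / 2 := by ring
      have h3 : 0 ≤ 1 + z * (1 - z) + z ^ 3 := by nlinarith [sq_nonneg z, sq_nonneg (z + 1 / 2)]
      have : 0 ≤ z ^ 2 * (1 + z * (1 - z) + z ^ 3) / 2 := by positivity
      linarith
    have h1 : 1 ≤ (1 + z) * (Real.exp (z - z ^ 2))⁻¹ :=
      hprod.trans (mul_le_mul_of_nonneg_left hq (by linarith))
    rwa [← div_eq_mul_inv, one_le_div hpos] at h1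

lemma sub_sq_le_log_one_add {z : ℝ} (hz : -(1 / 2) ≤ z) : z - z ^ 2 ≤ Real.log (1 + z) :=
  (Real.le_log_iff_exp_le (by linarith)).2 (exp_sub_sq_le hz)

/-- The point that a tilted mixture of experts with weights `w` and rates `η` plays. -/
noncomputable def tiltedMean {ι : Type*} (s : Finset ι) (w η : ι → ℝ) (p : ι → Vec d) : Vec d :=
  (∑ i ∈ s, w i * η i)⁻¹ • ∑ i ∈ s, (w i * η i) • p i

lemma tiltedMean_mem {ι : Type*} {s : Finset ι} {w η : ι → ℝ} {p : ι → Vec d}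
    (hX : Convex ℝ X) (hw : ∀ i ∈ s, 0 < w i) (hη : ∀ i ∈ s, 0 < η i) (hs : s.Nonempty)
    (hp : ∀ i ∈ s, p i ∈ X) : tiltedMean s w η p ∈ X :=
  hX.centerMass_mem (fun i hi => (mul_pos (hw i hi) (hη i hi)).le)
    (Finset.sum_pos (fun i hi => mul_pos (hw i hi) (hη i hi)) hs) hp

/-- The tilted mean is where the linearized gaps of the experts cancel. Hence the potential
`∑ wᵢ` does not grow when each weight is multiplied by `exp (-lossᵢ) ≤ 1 + ηᵢ ⟪g, x - pᵢ⟫`. -/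
lemma sum_mul_exp_neg_le_of_tiltedMean {ι : Type*} {s : Finset ι} {w η : ι → ℝ}
    {p : ι → Vec d} (loss : ι → ℝ) (g : Vec d) (hw : ∀ i ∈ s, 0 < w i) (hη : ∀ i ∈ s, 0 < η i)
    (hs : s.Nonempty)
    (hloss : ∀ i ∈ s, Real.exp (-loss i) ≤ 1 + η i * inner ℝ g (tiltedMean s w η p - p i)) :
    ∑ i ∈ s, w i * Real.exp (-loss i) ≤ ∑ i ∈ s, w i := by
  set x := tiltedMean s w η p with hx
  have hpos : 0 < ∑ i ∈ s, w i * η i :=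
    Finset.sum_pos (fun i hi => mul_pos (hw i hi) (hη i hi)) hs
  have hzero : ∑ i ∈ s, (w i * η i) * (inner ℝ g (x - p i) : ℝ) = 0 := by
    have h1 : (∑ i ∈ s, w i * η i) • x = ∑ i ∈ s, (w i * η i) • p i := by
      rw [hx, tiltedMean, smul_inv_smul₀ hpos.ne']
    have h2 : ∑ i ∈ s, (w i * η i) • (x - p i) = 0 := by
      simp only [smul_sub, Finset.sum_sub_distrib]
      rw [← Finset.sum_smul, h1, sub_self]
    have h3 := congrArg (fun v => (inner ℝ g v : ℝ)) h2
    simpa [inner_sum, real_inner_smul_right] using h3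
  calc ∑ i ∈ s, w i * Real.exp (-loss i)
      ≤ ∑ i ∈ s, w i * (1 + η i * inner ℝ g (x - p i)) :=
        Finset.sum_le_sum fun i hi => mul_le_mul_of_nonneg_left (hloss i hi) (hw i hi).le
    _ = ∑ i ∈ s, w i + ∑ i ∈ s, (w i * η i) * (inner ℝ g (x - p i) : ℝ) := by
        rw [← Finset.sum_add_distrib]
        exact Finset.sum_congr rfl fun i _ => by ring
    _ = ∑ i ∈ s, w i := by rw [hzero, add_zero]

lemma tiltedMean_const_mul {ι : Type*} (s : Finset ι) (w η : ι → ℝ) (p : ι → Vec d) {c : ℝ}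
    (hc : c ≠ 0) : tiltedMean s (fun i => c * w i) η p = tiltedMean s w η p := by
  have h1 : ∑ i ∈ s, c * w i * η i = c * ∑ i ∈ s, w i * η i := by
    rw [Finset.mul_sum]; exact Finset.sum_congr rfl fun i _ => by ring
  have h2 : ∑ i ∈ s, (c * w i * η i) • p i = c • ∑ i ∈ s, (w i * η i) • p i := by
    rw [Finset.smul_sum]
    exact Finset.sum_congr rfl fun i _ => by rw [smul_smul, mul_assoc]
  rw [tiltedMean, h1, h2, smul_smul, mul_inv, mul_right_comm, inv_mul_cancel₀ hc, one_mul,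
    tiltedMean]

lemma abs_inner_le_mul {G D : ℝ} {g v : Vec d} (hg : ‖g‖ ≤ G) (hv : ‖v‖ ≤ D) :
    |(inner ℝ g v : ℝ)| ≤ G * D :=
  (abs_real_inner_le_norm g v).trans
    (mul_le_mul hg hv (norm_nonneg v) ((norm_nonneg g).trans hg))

/-- A surrogate loss at least `-z + z²` with `z = η ⟪g, v⟫` small is exp-dominated by the
linearized gap. -/
lemma exp_neg_le_one_add_inner {G D η loss : ℝ} {g v : Vec d} (hη : 0 < η)
    (hηGD : η * (G * D) ≤ 1 / 2) (hg : ‖g‖ ≤ G) (hv : ‖v‖ ≤ D)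
    (hloss : -(η * inner ℝ g v) + (η * inner ℝ g v) ^ 2 ≤ loss) :
    Real.exp (-loss) ≤ 1 + η * inner ℝ g v := by
  have h := abs_le.1 (abs_inner_le_mul hg hv)
  refine le_trans (Real.exp_le_exp.2 ?_) (exp_sub_sq_le (z := η * inner ℝ g v) ?_)
  · linarith
  · nlinarith [mul_le_mul_of_nonneg_left h.1 hη.le]

/-! ### The grid of learning rates -/

lemma gridRate_pos {G D : ℝ} (hG : 0 < G) (hD : 0 < D) (i : ℕ) : 0 < gridRate G D i := by
  unfold gridRate; positivity

lemma gridRate_mul_le {G D : ℝ} (hG : 0 < G) (hD : 0 < D) (i : ℕ) :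
    gridRate G D i * (G * D) ≤ 1 / 5 := by
  have h : gridRate G D i * (G * D) = (2 : ℝ)⁻¹ ^ i / 5 := by
    unfold gridRate; field_simp
  have : (2 : ℝ)⁻¹ ^ i ≤ 1 := pow_le_one₀ (by norm_num) (by norm_num)
  rw [h]; linarith

lemma gridIdx_nonempty (T : ℕ) : (gridIdx T).Nonempty := ⟨0, by simp [gridIdx]⟩

lemma gridPrior_pos (T i : ℕ) : 0 < gridPrior T i := by
  unfold gridPrior; positivity

lemma sum_gridPrior (T : ℕ) : ∑ i ∈ gridIdx T, gridPrior T i = 1 := by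
  have h : ∀ n : ℕ, ∑ i ∈ Finset.range n, 1 / (((i : ℝ) + 1) * ((i : ℝ) + 2))
      = n / ((n : ℝ) + 1) := by
    intro n
    induction n with
    | zero => simp
    | succ n ih =>
      rw [Finset.sum_range_succ, ih]
      push_cast
      field_simp
      ring
  have h' := h (gridTop T + 1)
  have : ∑ i ∈ gridIdx T, gridPrior T i = (1 + 1 / (1 + (gridTop T : ℝ))) *
      ∑ i ∈ Finset.range (gridTop T + 1), 1 / (((i : ℝ) + 1) * ((i : ℝ) + 2)) := by
    rw [Finset.mul_sum]
    exact Finset.sum_congr rfl fun i _ => by unfold gridPrior; ring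
  rw [this, h']
  push_cast
  field_simp
  ring

lemma gridTop_le (T : ℕ) : gridTop T ≤ T := by
  refine Nat.ceil_le.2 ?_
  have h : Real.logb 2 (T : ℝ) ≤ T := by
    rcases Nat.eq_zero_or_pos T with h0 | h0
    · simp [h0]
    · rw [Real.logb_le_iff_le_rpow (by norm_num) (by exact_mod_cast h0), Real.rpow_natCast]
      exact_mod_cast Nat.lt_two_pow_self.le
  have : (0 : ℝ) ≤ T := Nat.cast_nonneg T
  linarith

lemma le_four_pow_gridTop {T : ℕ} (hT : 2 ≤ T) : (T : ℝ) ≤ 4 ^ gridTop T := by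
  have h := Nat.le_ceil ((1 / 2 : ℝ) * Real.logb 2 (T : ℝ))
  have h2 : Real.logb 2 (T : ℝ) ≤ ((2 * gridTop T : ℕ) : ℝ) := by
    push_cast
    unfold gridTop
    linarith
  rw [Real.logb_le_iff_le_rpow (by norm_num) (by positivity), Real.rpow_natCast, pow_mul] at h2
  norm_num at h2
  exact h2

lemma half_le_log {T : ℕ} (hT : 2 ≤ T) : 1 / 2 ≤ Real.log (T : ℝ) := by
  have h : Real.log 2 ≤ Real.log (T : ℝ) :=
    Real.log_le_log (by norm_num) (by exact_mod_cast hT)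
  linarith [Real.log_two_gt_d9]

lemma log_one_add_le {T : ℕ} (hT : 2 ≤ T) : Real.log (1 + (T : ℝ)) ≤ 2 * Real.log (T : ℝ) := by
  have hT' : (2 : ℝ) ≤ T := by exact_mod_cast hT
  rw [show (2 : ℝ) * Real.log (T : ℝ) = Real.log ((T : ℝ) ^ 2) by rw [Real.log_pow]; norm_num]
  exact Real.log_le_log (by linarith) (by nlinarith)

lemma neg_log_gridPrior_le {T i : ℕ} (hT : 2 ≤ T) (hi : i ∈ gridIdx T) :
    -Real.log (gridPrior T i / 3) ≤ 6 * Real.log (T : ℝ) := by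
  have hT' : (2 : ℝ) ≤ T := by exact_mod_cast hT
  have hi' : (i : ℝ) ≤ T := by
    have : i ≤ gridTop T := Nat.lt_succ_iff.1 (Finset.mem_range.1 hi)
    exact_mod_cast this.trans (gridTop_le T)
  have hi0 : (0 : ℝ) ≤ i := Nat.cast_nonneg i
  have hlow : 1 / ((T : ℝ) ^ 6) ≤ gridPrior T i / 3 := by
    have h1 : 1 / (((i : ℝ) + 1) * ((i : ℝ) + 2)) ≤ gridPrior T i := by
      unfold gridPrior
      gcongr
      have : 0 ≤ 1 / (1 + (gridTop T : ℝ)) := by positivity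
      linarith
    have h2 : 1 / ((T : ℝ) ^ 6) ≤ 1 / (((i : ℝ) + 1) * ((i : ℝ) + 2)) / 3 := by
      rw [div_div]
      refine one_div_le_one_div_of_le (by positivity) ?_
      calc ((i : ℝ) + 1) * ((i : ℝ) + 2) * 3 ≤ (T : ℝ) ^ 2 * (T : ℝ) ^ 2 * (T : ℝ) ^ 2 := by
            gcongr <;> nlinarith
        _ = (T : ℝ) ^ 6 := by ring
    linarith
  have := Real.log_le_log (by positivity) hlow
  rw [one_div, Real.log_inv, Real.log_pow] at this
  push_cast at this
  linarith

/-- Tuning the learning rate: if the regret `r` obeys `η r ≤ η² V + A` for every rate of the grid,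
it obeys the bound of the best rate `√(A / V)` up to constants. -/
lemma le_of_forall_gridRate {G D r V A : ℝ} {T : ℕ} (hT : 2 ≤ T) (hG : 0 < G) (hD : 0 < D)
    (hV0 : 0 ≤ V) (hV : V ≤ G ^ 2 * D ^ 2 * T) (hA : 1 / 25 ≤ A)
    (h : ∀ i ∈ gridIdx T, gridRate G D i * r ≤ gridRate G D i ^ 2 * V + A) :
    r ≤ 3 * √(A * V) + 10 * (G * D * A) := by
  have hGD : 0 < G * D := mul_pos hG hD
  have hsq : 0 ≤ √(A * V) := Real.sqrt_nonneg _
  rcases le_or_gt V (25 * (G * D) ^ 2 * A) with hsmall | hbig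
  · have h0 := h 0 (by simp [gridIdx])
    have hη : gridRate G D 0 = 1 / (5 * (G * D)) := by unfold gridRate; simp [mul_assoc]
    rw [hη] at h0
    have h1 : 1 / (5 * (G * D)) * r * (5 * (G * D))
        ≤ ((1 / (5 * (G * D))) ^ 2 * V + A) * (5 * (G * D)) :=
      mul_le_mul_of_nonneg_right h0 (by positivity)
    have h2 : (1 / (5 * (G * D))) ^ 2 * V ≤ A := by
      rw [one_div, inv_pow, inv_mul_le_iff₀ (by positivity)]
      nlinarith
    have h3 : 1 / (5 * (G * D)) * r * (5 * (G * D)) = r := by field_simp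
    rw [h3] at h1
    nlinarith
  · -- The largest rate of the grid with `η² V ≤ A` is within a factor `2` of `√(A / V)`.
    have hlast : gridRate G D (gridTop T) ^ 2 * V ≤ A := by
      have h4 := le_four_pow_gridTop hT
      have he : gridRate G D (gridTop T) ^ 2 = 1 / (4 ^ gridTop T * (25 * (G * D) ^ 2)) := by
        have : ((2 : ℝ)⁻¹ ^ gridTop T) ^ 2 = (4 ^ gridTop T)⁻¹ := by
          rw [← pow_mul, mul_comm, pow_mul, ← inv_pow]; norm_num
        unfold gridRate
        rw [div_pow, this]
        field_simp
        ring
      have hV' : V ≤ (G * D) ^ 2 * 4 ^ gridTop T := by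
        calc V ≤ (G * D) ^ 2 * T := by rw [mul_pow]; exact hV
          _ ≤ _ := by gcongr
      rw [he, one_div, inv_mul_le_iff₀ (by positivity)]
      have : 0 ≤ 4 ^ gridTop T * (G * D) ^ 2 := by positivity
      nlinarith
    classical
    have hex : ∃ i, gridRate G D i ^ 2 * V ≤ A := ⟨_, hlast⟩
    set i := Nat.find hex with hi
    have hle : i ≤ gridTop T := Nat.find_min' hex hlast
    have hiA : gridRate G D i ^ 2 * V ≤ A := Nat.find_spec hex
    have hi0 : i ≠ 0 := by
      intro h0
      rw [h0] at hiA
      have hη : gridRate G D 0 = 1 / (5 * (G * D)) := by unfold gridRate; simp [mul_assoc]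
      rw [hη, one_div, inv_pow, inv_mul_le_iff₀ (by positivity)] at hiA
      nlinarith
    obtain ⟨j, hj⟩ := Nat.exists_eq_succ_of_ne_zero hi0
    have hjA : A < gridRate G D j ^ 2 * V :=
      not_le.1 (Nat.find_min hex (show j < Nat.find hex by omega))
    have hjη : gridRate G D j = 2 * gridRate G D i := by
      rw [hj]; unfold gridRate; rw [pow_succ]; ring
    rw [hjη] at hjA
    set η := gridRate G D i
    have hη : 0 < η := gridRate_pos hG hD i
    have hreg := h i (Finset.mem_range.2 (Nat.lt_succ_of_le hle))
    have hA0 : 0 ≤ A := by linarith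
    -- With `s = √V` and `a = √A`: `η s ≤ a ≤ 2 η s`.
    have hs : √V ^ 2 = V := Real.sq_sqrt hV0
    have ha : √A ^ 2 = A := Real.sq_sqrt hA0
    have hsn : 0 ≤ √V := Real.sqrt_nonneg _
    have han : 0 ≤ √A := Real.sqrt_nonneg _
    have h1 : η * √V ≤ √A := by
      refine abs_le_of_sq_le_sq' ?_ han |>.2
      rw [mul_pow, hs, ha]; exact hiA
    have h2 : √A ≤ 2 * (η * √V) := by
      refine abs_le_of_sq_le_sq' ?_ (by positivity) |>.2
      rw [ha]
      nlinarith
    have h3 : η * r ≤ η * (3 * (√A * √V)) := by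
      calc η * r ≤ η ^ 2 * V + A := hreg
        _ = (η * √V) * (η * √V) + √A * √A := by rw [← sq, ← sq, ha, mul_pow, hs]
        _ ≤ √A * (η * √V) + √A * (2 * (η * √V)) := by gcongr
        _ = η * (3 * (√A * √V)) := by ring
    have h4 := le_of_mul_le_mul_left h3 hη
    rw [Real.sqrt_mul hA0]
    have : 0 ≤ G * D * A := by positivity
    linarith

/-! ### From a second-order bound to contaminated strong convexity -/

lemma OnlineAlgorithm.regret_le {A : OnlineAlgorithm d} {f : ℕ → Loss d} {T : ℕ} {R : ℝ}
    (hne : X.Nonempty)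
    (h : ∀ u ∈ X, ∑ t ∈ Finset.range T, ((f t).val (A.action f t) - (f t).val u) ≤ R) :
    A.regret X f T ≤ R := by
  have : ∑ t ∈ Finset.range T, (f t).val (A.action f t) - R ≤
      sInf ((fun x : Vec d => ∑ t ∈ Finset.range T, (f t).val x) '' X) := by
    refine le_csInf (hne.image _) ?_
    rintro _ ⟨u, hu, rfl⟩
    have := h u hu
    rw [Finset.sum_sub_distrib] at this
    linarith
  unfold OnlineAlgorithm.regret
  linarith

lemma regretBound_nonneg {G D lam d' : ℝ} (k : ℕ) {T : ℕ} (hG : 0 < G) (hD : 0 < D)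
    (hlam : 0 < lam) (hT : 2 ≤ T) (hd' : 0 ≤ d') : 0 ≤ regretBound G D lam k T d' := by
  have := half_le_log hT
  have : 0 ≤ Real.log (T : ℝ) := by linarith
  unfold regretBound
  positivity

lemma sqrt_add_le {x y : ℝ} (hx : 0 ≤ x) (hy : 0 ≤ y) : √(x + y) ≤ √x + √y := by
  rw [Real.sqrt_le_left (by positivity)]
  nlinarith [Real.sq_sqrt hx, Real.sq_sqrt hy, Real.sqrt_nonneg x, Real.sqrt_nonneg y,
    mul_nonneg (Real.sqrt_nonneg x) (Real.sqrt_nonneg y)]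

/-- A second-order bound `a √(B W) + b G D B` on the linearized regret, `W` the sum of the
`G² ‖y t - z t‖²`, is absorbed by the curvature of the uncontaminated losses: these contribute
`-λ/2 ‖y t - z t‖²` each, and every contaminated round adds at most `G² D²` to `W`. The
comparators `z t` may change with the round. -/
lemma sum_sub_le_of_second_order {f : ℕ → Loss d} {T k : ℕ} {G D lam a b B : ℝ}
    {y z : ℕ → Vec d} (hf : IsInstance X G D T f) (hlam : 0 < lam)
    (hcont : IsContaminated T k (Loss.IsStronglyConvex X lam) f)
    (hy : ∀ t < T, y t ∈ X) (hz : ∀ t < T, z t ∈ X) (ha : 0 ≤ a) (hb : 0 ≤ b) (hB : 0 ≤ B)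
    (h : ∑ t ∈ Finset.range T, (inner ℝ ((f t).grad (y t)) (y t - z t) : ℝ) ≤
      a * √(B * (G ^ 2 * ∑ t ∈ Finset.range T, ‖y t - z t‖ ^ 2)) + b * (G * D * B)) :
    ∑ t ∈ Finset.range T, ((f t).val (y t) - (f t).val (z t)) ≤
      (a ^ 2 / 2 + a + b) * ((G ^ 2 / lam + G * D) * B + G * D * √(k * B)) := by
  classical
  obtain ⟨I, hI, hcard, hsc⟩ := hcont
  have hG := hf.G_pos
  have hD := hf.D_pos
  set n : ℕ → ℝ := fun t => ‖y t - z t‖ ^ 2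
  set Q := ∑ t ∈ Finset.range T, if t ∈ I then 0 else n t with hQ
  have hQ0 : 0 ≤ Q := Finset.sum_nonneg fun t _ => by split_ifs <;> positivity
  have hlin : ∑ t ∈ Finset.range T, ((f t).val (y t) - (f t).val (z t)) ≤
      ∑ t ∈ Finset.range T, (inner ℝ ((f t).grad (y t)) (y t - z t) : ℝ) - lam / 2 * Q := by
    rw [hQ, Finset.mul_sum, ← Finset.sum_sub_distrib]
    refine Finset.sum_le_sum fun t ht => ?_
    have htT := Finset.mem_range.1 ht
    have hneg : (inner ℝ ((f t).grad (y t)) (z t - y t) : ℝ)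
        = -inner ℝ ((f t).grad (y t)) (y t - z t) := by
      rw [← inner_neg_right, neg_sub]
    by_cases htI : t ∈ I
    · have := (hf.loss t htT).le_add_inner (hy t htT) (hz t htT)
      simp only [htI, if_true]
      linarith
    · have := hsc t (Finset.mem_sdiff.2 ⟨ht, htI⟩) _ (hy t htT) _ (hz t htT)
      simp only [htI, if_false, n]
      linarith
  have hW : ∑ t ∈ Finset.range T, n t ≤ Q + k * D ^ 2 := by
    have hk : ∑ t ∈ Finset.range T, (if t ∈ I then D ^ 2 else 0) = k * D ^ 2 := by
      rw [← Finset.sum_filter, Finset.filter_mem_eq_inter, Finset.inter_eq_right.2 hI,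
        Finset.sum_const, hcard, nsmul_eq_mul]
    rw [← hk, hQ, ← Finset.sum_add_distrib]
    refine Finset.sum_le_sum fun t ht => ?_
    have htT := Finset.mem_range.1 ht
    split_ifs
    · rw [zero_add]
      exact pow_le_pow_left₀ (norm_nonneg _) (hf.diam_le _ (hy t htT) _ (hz t htT)) 2
    · simp
  have hsqrt : √(B * (G ^ 2 * ∑ t ∈ Finset.range T, n t)) ≤
      G * (√B * √Q) + G * D * √(k * B) := by
    calc √(B * (G ^ 2 * ∑ t ∈ Finset.range T, n t))
        ≤ √(G ^ 2 * (B * Q) + (G * D) ^ 2 * (k * B)) := by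
          refine Real.sqrt_le_sqrt ?_
          have := mul_le_mul_of_nonneg_left hW (mul_nonneg hB (sq_nonneg G))
          nlinarith
      _ ≤ √(G ^ 2 * (B * Q)) + √((G * D) ^ 2 * (k * B)) :=
          sqrt_add_le (by positivity) (by positivity)
      _ = _ := by
          rw [Real.sqrt_mul (sq_nonneg G), Real.sqrt_sq hG.le, Real.sqrt_mul hB,
            Real.sqrt_mul (sq_nonneg (G * D)), Real.sqrt_sq (mul_pos hG hD).le]
  have hamgm : a * (G * (√B * √Q)) ≤ lam / 2 * Q + a ^ 2 / 2 * (G ^ 2 / lam * B) := by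
    have h1 : √B ^ 2 = B := Real.sq_sqrt hB
    have h2 : √Q ^ 2 = Q := Real.sq_sqrt hQ0
    have h3 : 0 ≤ (lam * √Q - a * G * √B) ^ 2 / (2 * lam) := by positivity
    have h4 : (lam * √Q - a * G * √B) ^ 2 / (2 * lam)
        = lam / 2 * √Q ^ 2 + a ^ 2 / 2 * (G ^ 2 / lam * √B ^ 2) - a * (G * (√B * √Q)) := by
      field_simp
      ring
    rw [h1, h2] at h4
    linarith
  have hR1 : 0 ≤ G ^ 2 / lam * B := by positivity
  have hR2 : 0 ≤ G * D * B := by positivity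
  have hR3 : 0 ≤ G * D * √(k * B) := by positivity
  calc ∑ t ∈ Finset.range T, ((f t).val (y t) - (f t).val (z t))
      ≤ a * (G * (√B * √Q) + G * D * √(k * B)) + b * (G * D * B) - lam / 2 * Q := by
        have := mul_le_mul_of_nonneg_left hsqrt ha
        linarith
    _ ≤ a ^ 2 / 2 * (G ^ 2 / lam * B) + a * (G * D * √(k * B)) + b * (G * D * B) := by
        linarith
    _ ≤ (a ^ 2 / 2 + a + b) * (G ^ 2 / lam * B + G * D * B + G * D * √(k * B)) := by
        have ha2 : 0 ≤ a ^ 2 / 2 := by positivity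
        have e1 := mul_nonneg ha2 hR2
        have e2 := mul_nonneg ha2 hR3
        have e3 := mul_nonneg ha hR1
        have e4 := mul_nonneg ha hR2
        have e5 := mul_nonneg hb hR1
        have e6 := mul_nonneg hb hR3
        linarith
    _ = _ := by ring

/-! ### Maler -/

/-- The experts of Maler: the convex one, the strongly convex ones and the exp-concave ones. -/
noncomputable def malerIdx (T : ℕ) : Finset (Unit ⊕ ℕ ⊕ ℕ) :=
  Finset.univ.disjSum ((gridIdx T).disjSum (gridIdx T))

/-- The weights of all experts of Maler. -/
def malerWeight (s : MalerState d) : Unit ⊕ ℕ ⊕ ℕ → ℝ :=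
  Sum.elim (fun _ => s.wC) (Sum.elim s.wS s.wL)

/-- The unnormalized weights of all experts of Maler, prior times `exp (-cumulative loss)`. -/
noncomputable def malerPot (T : ℕ) (s : MalerState d) : Unit ⊕ ℕ ⊕ ℕ → ℝ :=
  Sum.elim (fun _ => 1 / 3 * Real.exp (-s.cumC))
    (Sum.elim (fun i => gridPrior T i / 3 * Real.exp (-s.cumS i))
      (fun i => gridPrior T i / 3 * Real.exp (-s.cumL i)))

/-- The learning rates of all experts of Maler. -/
noncomputable def malerRate (G D : ℝ) (T : ℕ) : Unit ⊕ ℕ ⊕ ℕ → ℝ :=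
  Sum.elim (fun _ => malerRateC G D T) (Sum.elim (gridRate G D) (gridRate G D))

/-- The points of all experts of Maler. -/
def malerPt (s : MalerState d) : Unit ⊕ ℕ ⊕ ℕ → Vec d :=
  Sum.elim (fun _ => s.ptC) (Sum.elim s.ptS s.ptL)

/-- The surrogate losses of all experts of Maler. -/
noncomputable def malerLoss (G D : ℝ) (T : ℕ) (s : MalerState d) (x g : Vec d) :
    Unit ⊕ ℕ ⊕ ℕ → ℝ :=
  Sum.elim (fun _ => cLoss G D (malerRateC G D T) x g s.ptC)
    (Sum.elim (fun i => sLoss G (gridRate G D i) x g (s.ptS i))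
      (fun i => lLoss (gridRate G D i) x g (s.ptL i)))

lemma malerIdx_nonempty (T : ℕ) : (malerIdx T).Nonempty :=
  ⟨Sum.inl (), by simp [malerIdx]⟩

lemma malerPot_pos (T : ℕ) (s : MalerState d) (e : Unit ⊕ ℕ ⊕ ℕ) : 0 < malerPot T s e := by
  rcases e with _ | i | i <;> simp only [malerPot, Sum.elim_inl, Sum.elim_inr]
  · positivity
  all_goals
    have := gridPrior_pos T i
    positivity

lemma malerRateC_pos {G D : ℝ} {T : ℕ} (hG : 0 < G) (hD : 0 < D) (hT : 2 ≤ T) :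
    0 < malerRateC G D T := by
  have : (0 : ℝ) < T := by exact_mod_cast (by omega : 0 < T)
  unfold malerRateC
  positivity

lemma malerRateC_mul_le {G D : ℝ} {T : ℕ} (hG : 0 < G) (hD : 0 < D) (hT : 2 ≤ T) :
    malerRateC G D T * (G * D) ≤ 1 / 2 := by
  have h1 : 1 ≤ √(T : ℝ) := Real.one_le_sqrt.2 (by exact_mod_cast (by omega : 1 ≤ T))
  have h : malerRateC G D T * (G * D) = 1 / (2 * √(T : ℝ)) := by
    unfold malerRateC; field_simp
  rw [h]
  exact one_div_le_one_div_of_le (by norm_num) (by linarith)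

lemma malerRate_pos {G D : ℝ} {T : ℕ} (hG : 0 < G) (hD : 0 < D) (hT : 2 ≤ T)
    (e : Unit ⊕ ℕ ⊕ ℕ) : 0 < malerRate G D T e := by
  rcases e with _ | i | i <;> simp only [malerRate, Sum.elim_inl, Sum.elim_inr]
  · exact malerRateC_pos hG hD hT
  all_goals exact gridRate_pos hG hD i

lemma malerPlay_eq_tiltedMean (G D : ℝ) (T : ℕ) (s : MalerState d) :
    malerPlay G D T s =
      tiltedMean (malerIdx T) (malerWeight s) (malerRate G D T) (malerPt s) := by
  simp [malerPlay, tiltedMean, malerIdx, malerWeight, malerRate, malerPt, Finset.sum_disjSum,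
    Finset.sum_add_distrib]

lemma malerPhi_eq_sum (T : ℕ) (s : MalerState d) :
    malerPhi T s.cumC s.cumS s.cumL = ∑ e ∈ malerIdx T, malerPot T s e := by
  simp [malerPhi, malerIdx, malerPot, Finset.sum_disjSum, Finset.sum_add_distrib]
  ring

lemma malerPhi_pos (T : ℕ) (s : MalerState d) : 0 < malerPhi T s.cumC s.cumS s.cumL := by
  rw [malerPhi_eq_sum]
  exact Finset.sum_pos (fun e _ => malerPot_pos T s e) (malerIdx_nonempty T)

lemma malerPot_malerStep (G D : ℝ) (T : ℕ) (s : MalerState d) (x g : Vec d)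
    (e : Unit ⊕ ℕ ⊕ ℕ) : malerPot T (malerStep X G D T s x g) e =
      malerPot T s e * Real.exp (-malerLoss G D T s x g e) := by
  rcases e with _ | i | i <;>
    simp only [malerPot, malerLoss, malerStep, Sum.elim_inl, Sum.elim_inr] <;>
    rw [neg_add, Real.exp_add, mul_assoc]

lemma malerWeight_malerStep (G D : ℝ) (T : ℕ) (s : MalerState d) (x g : Vec d)
    (e : Unit ⊕ ℕ ⊕ ℕ) : malerWeight (malerStep X G D T s x g) e =
      malerWeight s e * Real.exp (-malerLoss G D T s x g e) /
        (let s' := malerStep X G D T s x g; malerPhi T s'.cumC s'.cumS s'.cumL) := by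
  rcases e with _ | i | i <;> rfl

section

variable {x₀ : Vec d} {G D : ℝ} {T : ℕ} {f : ℕ → Loss d}

/-- The state of Maler before round `t`. -/
noncomputable def malerRun (X : Set (Vec d)) (x₀ : Vec d) (G D : ℝ) (T : ℕ) (f : ℕ → Loss d)
    (t : ℕ) : MalerState d := (maler X x₀ G D T).state f t

local notation "mstate" => malerRun X x₀ G D T f
local notation "maction" => OnlineAlgorithm.action (maler X x₀ G D T) f

lemma maler_state_succ (t : ℕ) : (mstate (t + 1)) =
    malerStep X G D T (mstate t) (maction t) ((f t).grad (maction t)) := rfl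

/-- The weights differ from the unnormalized ones by a common factor. -/
lemma maler_weight_eq (t : ℕ) : ∃ c : ℝ, 0 < c ∧
    malerWeight (mstate t) = fun e => c * malerPot T (mstate t) e := by
  induction t with
  | zero =>
    refine ⟨1, one_pos, funext fun e => ?_⟩
    rcases e with _ | i | i <;>
      simp [malerWeight, malerPot, malerRun, OnlineAlgorithm.state, maler]
  | succ t ih =>
    obtain ⟨c, hc, h⟩ := ih
    refine ⟨c / malerPhi T (mstate (t + 1)).cumC (mstate (t + 1)).cumS
      (mstate (t + 1)).cumL, div_pos hc (malerPhi_pos T _), funext fun e => ?_⟩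
    have hw := malerWeight_malerStep (X := X) G D T (mstate t) (maction t)
      ((f t).grad (maction t)) e
    rw [← maler_state_succ, h] at hw
    rw [hw, maler_state_succ, malerPot_malerStep]
    ring

lemma maler_action_eq_tiltedMean (t : ℕ) : maction t =
    tiltedMean (malerIdx T) (malerPot T (mstate t)) (malerRate G D T)
      (malerPt (mstate t)) := by
  obtain ⟨c, hc, h⟩ := maler_weight_eq (X := X) (x₀ := x₀) (G := G) (D := D) (T := T) (f := f) t
  rw [← tiltedMean_const_mul _ _ _ _ hc.ne', ← h]
  exact malerPlay_eq_tiltedMean G D T _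

lemma maler_pt_mem (hX : IsCompact X) (hx₀ : x₀ ∈ X) (t : ℕ) (e : Unit ⊕ ℕ ⊕ ℕ) :
    malerPt (mstate t) e ∈ X := by
  cases t with
  | zero => rcases e with _ | i | i <;> exact hx₀
  | succ t =>
    rcases e with _ | i | i
    · exact proj_mem hX ⟨_, hx₀⟩ _
    · exact proj_mem hX ⟨_, hx₀⟩ _
    · exact (projOf_spec hX ⟨_, hx₀⟩ _ _).1

lemma maler_action_mem (hf : IsInstance X G D T f) (hx₀ : x₀ ∈ X) (hT : 2 ≤ T) (t : ℕ) :
    maction t ∈ X := by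
  rw [maler_action_eq_tiltedMean]
  exact tiltedMean_mem hf.convex (fun e _ => malerPot_pos T _ e)
    (fun e _ => malerRate_pos hf.G_pos hf.D_pos hT e) (malerIdx_nonempty T)
    (fun e _ => maler_pt_mem hf.isCompact hx₀ t e)

lemma maler_sum_malerPot_le_one (hf : IsInstance X G D T f) (hx₀ : x₀ ∈ X) (hT : 2 ≤ T) {t : ℕ}
    (ht : t ≤ T) : ∑ e ∈ malerIdx T, malerPot T (mstate t) e ≤ 1 := by
  have hG := hf.G_pos
  have hD := hf.D_pos
  induction t with
  | zero =>
    have h := sum_gridPrior T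
    simp [malerIdx, malerPot, malerRun, OnlineAlgorithm.state, maler, Finset.sum_disjSum,
      ← Finset.sum_div, h]
    norm_num
  | succ t ih =>
    refine le_trans ?_ (ih (by omega))
    rw [maler_state_succ]
    simp only [malerPot_malerStep]
    have hx := maler_action_mem hf hx₀ hT t
    have hg := hf.grad_le t (by omega) _ hx
    have key := sum_mul_exp_neg_le_of_tiltedMean (s := malerIdx T)
      (w := malerPot T (mstate t)) (η := malerRate G D T)
      (p := malerPt (mstate t))
      (malerLoss G D T (mstate t) (maction t) ((f t).grad (maction t)))
      ((f t).grad (maction t)) (fun e _ => malerPot_pos T _ e)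
      (fun e _ => malerRate_pos hG hD hT e) (malerIdx_nonempty T)
    rw [← maler_action_eq_tiltedMean] at key
    refine key fun e _ => ?_
    have hv := hf.diam_le _ hx _ (maler_pt_mem (x₀ := x₀) (f := f) (T := T) (G := G) (D := D)
      hf.isCompact hx₀ t e)
    refine exp_neg_le_one_add_inner (malerRate_pos hG hD hT e) ?_ hg hv ?_
    · rcases e with _ | i | i
      · exact malerRateC_mul_le hG hD hT
      · exact (gridRate_mul_le hG hD i).trans (by norm_num)
      · exact (gridRate_mul_le hG hD i).trans (by norm_num)
    · have habs := abs_inner_le_mul hg hv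
      rcases e with _ | i | i <;>
        simp only [malerPt, malerLoss, malerRate, Sum.elim_inl, Sum.elim_inr, cLoss, sLoss,
          lLoss, mul_pow, neg_mul] at habs hv ⊢
      · have := pow_le_pow_left₀ (abs_nonneg _) habs 2
        rw [sq_abs] at this
        have := mul_le_mul_of_nonneg_left this (sq_nonneg (malerRateC G D T))
        nlinarith
      · have hcs := abs_real_inner_le_norm ((f t).grad (maction t))
          (maction t - (mstate t).ptS i)
        have := pow_le_pow_left₀ (abs_nonneg _)
          (hcs.trans (mul_le_mul_of_nonneg_right hg (norm_nonneg _))) 2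
        rw [sq_abs, mul_pow] at this
        have := mul_le_mul_of_nonneg_left this (sq_nonneg (gridRate G D i))
        linarith
      · rfl

lemma maler_neg_cumS_le (hf : IsInstance X G D T f) (hx₀ : x₀ ∈ X) (hT : 2 ≤ T) {i : ℕ}
    (hi : i ∈ gridIdx T) : -(mstate T).cumS i ≤ 6 * Real.log (T : ℝ) := by
  have h1 := (Finset.single_le_sum (fun e _ => (malerPot_pos T (mstate T) e).le)
    (show Sum.inr (Sum.inl i) ∈ malerIdx T by simpa [malerIdx] using hi)).trans
    (maler_sum_malerPot_le_one hf hx₀ hT le_rfl)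
  have hp : 0 < gridPrior T i / 3 := div_pos (gridPrior_pos T i) (by norm_num)
  simp only [malerPot, Sum.elim_inl, Sum.elim_inr] at h1
  have h2 := Real.log_le_log (mul_pos hp (Real.exp_pos _)) h1
  rw [Real.log_mul hp.ne' (Real.exp_pos _).ne', Real.log_exp, Real.log_one] at h2
  have := neg_log_gridPrior_le hT hi
  linarith

lemma maler_round (t : ℕ) : (mstate t).round = t + 1 := by
  induction t with
  | zero => rfl
  | succ t ih =>
    have h : (mstate (t + 1)).round = (mstate t).round + 1 := rfl
    rw [h, ih]

/-- Gradient descent with step `1 / (μ n)`, `μ = 2 η² G²`, on the `μ`-strongly convex surrogate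
loss: the potential `(n - 1) μ/2 ‖p - u‖²` pays for the regret up to `1 / (2 n)`. -/
lemma sLoss_sub_le {η : ℝ} {x g p u : Vec d} {n : ℝ} (hX : IsCompact X) (hc : Convex ℝ X)
    (hη : 0 < η) (hG : 0 < G) (hη5 : η * (G * D) ≤ 1 / 5) (hg : ‖g‖ ≤ G) (hxp : ‖p - x‖ ≤ D)
    (hu : u ∈ X) (hn : 0 < n) :
    sLoss G η x g p - sLoss G η x g u ≤
      η ^ 2 * G ^ 2 * ((n - 1) * ‖p - u‖ ^ 2 -
        n * ‖proj X (p - (1 / (2 * η ^ 2 * G ^ 2 * n)) • sGrad G η x g p) - u‖ ^ 2)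
      + 1 / (2 * n) := by
  set q := sGrad G η x g p with hq
  set α := 1 / (2 * η ^ 2 * G ^ 2 * n) with hα
  set p' := proj X (p - α • q)
  have h1 : ‖p' - u‖ ^ 2 ≤ ‖p - u‖ ^ 2 - 2 * α * inner ℝ q (p - u) + α ^ 2 * ‖q‖ ^ 2 := by
    refine (norm_proj_sub_sq_le hX hc _ hu).trans_eq ?_
    rw [show p - α • q - u = (p - u) - α • q by abel, norm_sub_sq_real, norm_smul,
      real_inner_smul_right, mul_pow, Real.norm_eq_abs, sq_abs, real_inner_comm]
    ring
  have h2 : sLoss G η x g p - sLoss G η x g u =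
      inner ℝ q (p - u) - η ^ 2 * G ^ 2 * ‖p - u‖ ^ 2 := by
    rw [hq, sGrad, inner_add_left, real_inner_smul_left, real_inner_smul_left, sLoss, sLoss]
    have e1 : ‖x - u‖ ^ 2 = ‖x - p‖ ^ 2 + 2 * inner ℝ (x - p) (p - u) + ‖p - u‖ ^ 2 := by
      rw [← norm_add_sq_real]; congr 2; abel
    have e2 : (inner ℝ (p - x) (p - u) : ℝ) = -inner ℝ (x - p) (p - u) := by
      rw [← inner_neg_left, neg_sub]
    have e3 : (inner ℝ g (p - u) : ℝ) = inner ℝ g (x - u) - inner ℝ g (x - p) := by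
      rw [← inner_sub_right]; congr 1; abel
    rw [e1, e2, e3]
    ring
  have h3 : ‖q‖ ^ 2 ≤ 2 * η ^ 2 * G ^ 2 := by
    have : ‖q‖ ≤ η * G * (7 / 5) := by
      calc ‖q‖ ≤ ‖η • g‖ + ‖(2 * η ^ 2 * G ^ 2) • (p - x)‖ := norm_add_le _ _
        _ = η * ‖g‖ + 2 * η ^ 2 * G ^ 2 * ‖p - x‖ := by
          rw [norm_smul, norm_smul, Real.norm_of_nonneg hη.le, Real.norm_of_nonneg (by positivity)]
        _ ≤ η * G + 2 * η ^ 2 * G ^ 2 * D := by gcongr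
        _ = η * G + 2 * (η * G) * (η * (G * D)) := by ring
        _ ≤ η * G + 2 * (η * G) * (1 / 5) := by gcongr
        _ = η * G * (7 / 5) := by ring
    have h4 := pow_le_pow_left₀ (norm_nonneg q) this 2
    have : 0 ≤ η ^ 2 * G ^ 2 := by positivity
    nlinarith
  have hμ : 0 < η ^ 2 * G ^ 2 := by positivity
  have hαn : η ^ 2 * G ^ 2 * n * α = 1 / 2 := by rw [hα]; field_simp
  have h5 := mul_le_mul_of_nonneg_left h1 (mul_pos hμ hn).le
  have h6 : η ^ 2 * G ^ 2 * n * (α ^ 2 * ‖q‖ ^ 2) ≤ 1 / (2 * n) := by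
    calc η ^ 2 * G ^ 2 * n * (α ^ 2 * ‖q‖ ^ 2)
        ≤ η ^ 2 * G ^ 2 * n * (α ^ 2 * (2 * η ^ 2 * G ^ 2)) := by gcongr
      _ = (η ^ 2 * G ^ 2 * n * α) ^ 2 * 2 / n := by field_simp
      _ = 1 / (2 * n) := by rw [hαn]; field_simp
  have h7 : η ^ 2 * G ^ 2 * n * (2 * α * inner ℝ q (p - u)) = inner ℝ q (p - u) := by
    calc _ = 2 * (η ^ 2 * G ^ 2 * n * α) * inner ℝ q (p - u) := by ring
      _ = _ := by rw [hαn]; ring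
  rw [h2]
  linarith

/-- Regret of a strongly convex expert: the potentials of `sLoss_sub_le` telescope, and the rest is
half a harmonic sum. -/
lemma maler_cumS_le (hf : IsInstance X G D T f) (hx₀ : x₀ ∈ X) (hT : 2 ≤ T) (i : ℕ)
    {u : Vec d} (hu : u ∈ X) {t : ℕ} (ht : t ≤ T) :
    (mstate t).cumS i - ∑ r ∈ Finset.range t,
        sLoss G (gridRate G D i) (maction r) ((f r).grad (maction r)) u ≤
      -(gridRate G D i ^ 2 * G ^ 2 * (t * ‖(mstate t).ptS i - u‖ ^ 2)) +
        (harmonic t : ℝ) / 2 := by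
  have hG := hf.G_pos
  have hD := hf.D_pos
  induction t with
  | zero => simp [malerRun, OnlineAlgorithm.state, maler]
  | succ t ih =>
    have hx := maler_action_mem hf hx₀ hT t
    have hp : (mstate t).ptS i ∈ X :=
      maler_pt_mem hf.isCompact hx₀ t (Sum.inr (Sum.inl i))
    have hstep := sLoss_sub_le (n := ((mstate t).round : ℝ)) hf.isCompact hf.convex
      (gridRate_pos hG hD i) hG (gridRate_mul_le hG hD i) (hf.grad_le t (by omega) _ hx)
      (hf.diam_le _ hp _ hx) hu (by rw [maler_round]; positivity)
    have hcum : (mstate (t + 1)).cumS i = (mstate t).cumS i +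
        sLoss G (gridRate G D i) (maction t) ((f t).grad (maction t))
          ((mstate t).ptS i) := rfl
    have hpt : (mstate (t + 1)).ptS i = proj X ((mstate t).ptS i -
        (1 / (2 * gridRate G D i ^ 2 * G ^ 2 * ((mstate t).round : ℝ))) •
        sGrad G (gridRate G D i) (maction t) ((f t).grad (maction t))
          ((mstate t).ptS i)) := rfl
    rw [← hpt, maler_round] at hstep
    have ih' := ih (by omega)
    rw [Finset.sum_range_succ, hcum, harmonic_succ]
    push_cast at hstep ⊢
    have e : (1 : ℝ) / (2 * (t + 1)) = ((t : ℝ) + 1)⁻¹ / 2 := by field_simp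
    rw [e] at hstep
    linarith

/-- The second-order bound of Maler, `∑ ⟪g_t, x_t - u⟫ = O(√(log T ∑ G² ‖x_t - u‖²) + G D log T)`;
it comes from the strongly convex experts alone. -/
lemma maler_second_order (hf : IsInstance X G D T f) (hx₀ : x₀ ∈ X) (hT : 2 ≤ T)
    {u : Vec d} (hu : u ∈ X) :
    ∑ t ∈ Finset.range T, (inner ℝ ((f t).grad (maction t)) (maction t - u) : ℝ) ≤
      9 * √(Real.log (T : ℝ) * (G ^ 2 * ∑ t ∈ Finset.range T, ‖maction t - u‖ ^ 2)) +
        80 * (G * D * Real.log (T : ℝ)) := by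
  have hG := hf.G_pos
  have hD := hf.D_pos
  have hlog := half_le_log hT
  have hW0 : 0 ≤ G ^ 2 * ∑ t ∈ Finset.range T, ‖maction t - u‖ ^ 2 := by positivity
  have hW : G ^ 2 * ∑ t ∈ Finset.range T, ‖maction t - u‖ ^ 2 ≤ G ^ 2 * D ^ 2 * T := by
    rw [mul_assoc]
    gcongr
    calc ∑ t ∈ Finset.range T, ‖maction t - u‖ ^ 2 ≤ ∑ t ∈ Finset.range T, D ^ 2 :=
          Finset.sum_le_sum fun t _ => pow_le_pow_left₀ (norm_nonneg _)
            (hf.diam_le _ (maler_action_mem hf hx₀ hT t) _ hu) 2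
      _ = D ^ 2 * T := by simp [mul_comm]
  refine (le_of_forall_gridRate (A := 8 * Real.log (T : ℝ)) hT hG hD hW0 hW (by linarith)
    fun i hi => ?_).trans ?_
  · have h1 := maler_neg_cumS_le hf hx₀ hT hi
    have h2 := maler_cumS_le hf hx₀ hT i hu le_rfl
    have h3 := harmonic_le_one_add_log T
    have h4 : 0 ≤ gridRate G D i ^ 2 * G ^ 2 * (T * ‖(mstate T).ptS i - u‖ ^ 2) := by
      positivity
    have h5 : ∑ r ∈ Finset.range T,
        sLoss G (gridRate G D i) (maction r) ((f r).grad (maction r)) u =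
        -(gridRate G D i * ∑ t ∈ Finset.range T,
            (inner ℝ ((f t).grad (maction t)) (maction t - u) : ℝ)) +
          gridRate G D i ^ 2 * (G ^ 2 * ∑ t ∈ Finset.range T, ‖maction t - u‖ ^ 2) := by
      simp only [sLoss, Finset.sum_add_distrib, Finset.mul_sum, neg_mul, Finset.sum_neg_distrib,
        mul_assoc]
    linarith
  · have h9 : 3 * √(8 * Real.log (T : ℝ) *
        (G ^ 2 * ∑ t ∈ Finset.range T, ‖maction t - u‖ ^ 2)) ≤
        9 * √(Real.log (T : ℝ) * (G ^ 2 * ∑ t ∈ Finset.range T, ‖maction t - u‖ ^ 2)) := by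
      rw [mul_assoc, Real.sqrt_mul (by norm_num)]
      have : √(8 : ℝ) ≤ 3 := by rw [Real.sqrt_le_left (by norm_num)]; norm_num
      nlinarith [Real.sqrt_nonneg (Real.log (T : ℝ) *
        (G ^ 2 * ∑ t ∈ Finset.range T, ‖maction t - u‖ ^ 2))]
    linarith

lemma maler_sum_sub_le {k : ℕ} {lam : ℝ} (hf : IsInstance X G D T f) (hx₀ : x₀ ∈ X) (hT : 2 ≤ T)
    (hlam : 0 < lam) (hcont : IsContaminated T k (Loss.IsStronglyConvex X lam) f)
    {u : Vec d} (hu : u ∈ X) :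
    ∑ t ∈ Finset.range T, ((f t).val (maction t) - (f t).val u) ≤
      (9 ^ 2 / 2 + 9 + 80) * regretBound G D lam k T 1 := by
  have := half_le_log hT
  have h := sum_sub_le_of_second_order hf hlam hcont
    (fun t _ => maler_action_mem hf hx₀ hT t) (fun t _ => hu) (by norm_num) (by norm_num)
    (by linarith) (maler_second_order hf hx₀ hT hu)
  simpa only [regretBound, mul_one] using h

end

/-! ### Determinants and the online Newton step -/

lemma normSqOf_add_mat (A B : Matrix (Fin d) (Fin d) ℝ) (v : Vec d) :
    normSqOf (A + B) v = normSqOf A v + normSqOf B v := by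
  simp only [normSqOf, mulV_add_mat, inner_add_left]

lemma normSqOf_smul_mat (c : ℝ) (A : Matrix (Fin d) (Fin d) ℝ) (v : Vec d) :
    normSqOf (c • A) v = c * normSqOf A v := by
  simp only [normSqOf, mulV_smul_mat, real_inner_smul_left]

lemma normSqOf_outer (g v : Vec d) : normSqOf (outer g) v = (inner ℝ g v : ℝ) ^ 2 := by
  rw [normSqOf, mulV_outer, real_inner_smul_left, sq]

lemma posSemidef_outer (g : Vec d) : (outer g).PosSemidef := by
  simpa [outer] using Matrix.posSemidef_vecMulVec_self_star g.ofLp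

lemma trace_outer (g : Vec d) : (outer g).trace = ‖g‖ ^ 2 := by
  rw [EuclideanSpace.real_norm_sq_eq]
  simp [outer, Matrix.trace, Matrix.vecMulVec_apply, sq]

/-- By the matrix determinant lemma `det M = det N (1 - c ‖g‖²_{N⁻¹})` for `N = M + c g gᵀ`, and
`z ≤ -log (1 - z)`. -/
lemma mul_normSqOf_inv_le_log_det {M : Matrix (Fin d) (Fin d) ℝ} (hM : M.PosDef) {c : ℝ}
    {g : Vec d} (hN : (M + c • outer g).PosDef) :
    c * normSqOf (M + c • outer g)⁻¹ g ≤
      Real.log (M + c • outer g).det - Real.log M.det := by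
  set N := M + c • outer g with hNdef
  have hdet : M.det = N.det * (1 - c * normSqOf N⁻¹ g) := by
    have h : M = N + Matrix.replicateCol Unit (-c • g.ofLp) * Matrix.replicateRow Unit g.ofLp := by
      have : Matrix.replicateCol Unit (-c • g.ofLp) * Matrix.replicateRow Unit g.ofLp
          = -(c • outer g) := by
        ext i j
        simp [outer, Matrix.vecMulVec_apply, Matrix.mul_apply, mul_assoc]
      rw [this, hNdef]; abel
    conv_lhs => rw [h]
    rw [Matrix.det_add_replicateCol_mul_replicateRow ((Matrix.isUnit_iff_isUnit_det N).1 hN.isUnit)]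
    congr 1
    have h2 : normSqOf N⁻¹ g = g.ofLp ⬝ᵥ (N⁻¹.mulVec g.ofLp) := by
      simp [normSqOf, mulV, EuclideanSpace.inner_eq_star_dotProduct]
    rw [h2, Matrix.det_unique, Matrix.mul_assoc, Matrix.add_apply, Matrix.one_apply_eq,
      sub_eq_add_neg]
    congr 1
    rw [← Matrix.replicateCol_mulVec, Matrix.replicateRow_mul_replicateCol_apply,
      Matrix.mulVec_smul, dotProduct_smul]
    simp
  have hMp := hM.det_pos
  have hNp := hN.det_pos
  have hz : 0 < 1 - c * normSqOf N⁻¹ g := by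
    rw [hdet] at hMp
    exact pos_of_mul_pos_right hMp hNp.le
  rw [hdet, Real.log_mul hNp.ne' hz.ne']
  have := Real.log_le_sub_one_of_pos hz
  linarith

/-- The bound `log x ≤ x / c - 1 + log c` summed over the eigenvalues. -/
lemma log_det_le {A : Matrix (Fin d) (Fin d) ℝ} (hA : A.PosDef) {c : ℝ} (hc : 0 < c) :
    Real.log A.det ≤ A.trace / c - d + d * Real.log c := by
  have hdet := hA.1.det_eq_prod_eigenvalues
  have htr := hA.1.trace_eq_sum_eigenvalues
  simp only [RCLike.ofReal_real_eq_id, id] at hdet htr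
  rw [hdet, htr, Real.log_prod (fun i _ => (hA.eigenvalues_pos i).ne'), Finset.sum_div]
  have : ∀ i, Real.log (hA.1.eigenvalues i) ≤ hA.1.eigenvalues i / c - 1 + Real.log c := by
    intro i
    have hi := hA.eigenvalues_pos i
    have := Real.log_le_sub_one_of_pos (div_pos hi hc)
    rw [Real.log_div hi.ne' hc.ne'] at this
    linarith
  calc _ ≤ ∑ i, (hA.1.eigenvalues i / c - 1 + Real.log c) := Finset.sum_le_sum fun i _ => this i
    _ = _ := by simp [Finset.sum_add_distrib, Finset.sum_sub_distrib]

/-- The matrix `D⁻² I + 2 η² S`, the inverse of the matrix `Σ` of a MetaGrad slave. -/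
noncomputable def newtonMat (D η : ℝ) (S : Matrix (Fin d) (Fin d) ℝ) :
    Matrix (Fin d) (Fin d) ℝ :=
  (1 / D ^ 2) • (1 : Matrix (Fin d) (Fin d) ℝ) + (2 * η ^ 2) • S

lemma posDef_newtonMat {D η : ℝ} (hD : 0 < D) {S : Matrix (Fin d) (Fin d) ℝ}
    (hS : S.PosSemidef) : (newtonMat D η S).PosDef :=
  (Matrix.PosDef.one.smul (by positivity)).add_posSemidef (hS.smul (by positivity))

lemma newtonMat_add_outer (D η : ℝ) (S : Matrix (Fin d) (Fin d) ℝ) (g : Vec d) :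
    newtonMat D η (S + outer g) = newtonMat D η S + (2 * η ^ 2) • outer g := by
  simp only [newtonMat, smul_add, add_assoc]

lemma metaGradSigma_inv {D η : ℝ} (hD : 0 < D) {S : Matrix (Fin d) (Fin d) ℝ}
    (hS : S.PosSemidef) : (metaGradSigma D η S)⁻¹ = newtonMat D η S :=
  Matrix.nonsing_inv_nonsing_inv _
    ((Matrix.isUnit_iff_isUnit_det _).1 (posDef_newtonMat hD hS).isUnit)

lemma log_det_newtonMat_sub_le {D η G : ℝ} (hD : 0 < D) (hG : 0 < G) (hη : 0 < η)
    (hη5 : η * (G * D) ≤ 1 / 5) {S : Matrix (Fin d) (Fin d) ℝ} (hS : S.PosSemidef) {T : ℕ}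
    (htr : S.trace ≤ T * G ^ 2) :
    Real.log (newtonMat D η S).det - Real.log (newtonMat D η (0 : Matrix (Fin d) (Fin d) ℝ)).det
      ≤ d * Real.log (1 + (T : ℝ)) := by
  have hT : (0 : ℝ) ≤ T := Nat.cast_nonneg T
  have hd : (0 : ℝ) ≤ d := Nat.cast_nonneg d
  have h0 : Real.log (newtonMat D η (0 : Matrix (Fin d) (Fin d) ℝ)).det =
      d * Real.log (1 / D ^ 2) := by
    simp [newtonMat, Real.log_pow]
  rcases Nat.eq_zero_or_pos d with hd0 | hdpos
  · subst hd0
    simp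
  have hd1 : (1 : ℝ) ≤ d := by exact_mod_cast hdpos
  have h1 := log_det_le (posDef_newtonMat (η := η) hD hS)
    (c := 1 / D ^ 2 * (1 + T)) (by positivity)
  rw [Real.log_mul (by positivity) (by positivity)] at h1
  have htrace : (newtonMat D η S).trace / (1 / D ^ 2 * (1 + T)) ≤ d := by
    rw [div_le_iff₀ (by positivity)]
    have e : (newtonMat D η S).trace = 1 / D ^ 2 * d + 2 * η ^ 2 * S.trace := by
      simp [newtonMat, Matrix.trace_add, Matrix.trace_smul]
    have h2 : 2 * η ^ 2 * S.trace ≤ 1 / D ^ 2 * T := by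
      have h3 : (η * (G * D)) ^ 2 ≤ (1 / 5) ^ 2 := pow_le_pow_left₀ (by positivity) hη5 2
      calc 2 * η ^ 2 * S.trace ≤ 2 * η ^ 2 * (T * G ^ 2) := by gcongr
        _ = 2 * (η * (G * D)) ^ 2 * (1 / D ^ 2 * T) := by field_simp
        _ ≤ 1 * (1 / D ^ 2 * T) := by gcongr; linarith
        _ = _ := one_mul _
    rw [e]
    have h4 : 0 ≤ 1 / D ^ 2 * (T : ℝ) := by positivity
    nlinarith
  linarith

/-- One projected Newton step on the exp-concave surrogate loss. The loss is quadratic in the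
direction `g`, and its curvature pays for the growth of the norm. -/
lemma two_mul_lLoss_sub_le {η G D : ℝ} {x g p u : Vec d} (hX : IsCompact X) (hc : Convex ℝ X)
    (hη : 0 < η) (hη5 : η * (G * D) ≤ 1 / 5) (hg : ‖g‖ ≤ G) (hxp : ‖p - x‖ ≤ D) (hu : u ∈ X)
    {M : Matrix (Fin d) (Fin d) ℝ} (hM : M.PosDef) (hN : (M + (2 * η ^ 2) • outer g).PosDef) :
    2 * (lLoss η x g p - lLoss η x g u) ≤
      normSqOf M (p - u) -
        normSqOf (M + (2 * η ^ 2) • outer g) (projOf X (M + (2 * η ^ 2) • outer g)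
          (p - mulV (M + (2 * η ^ 2) • outer g)⁻¹ (lGrad η x g p)) - u) +
      (Real.log (M + (2 * η ^ 2) • outer g).det - Real.log M.det) := by
  have hdet := mul_normSqOf_inv_le_log_det hM hN
  set N := M + (2 * η ^ 2) • outer g with hNdef
  set q := lGrad η x g p with hq
  set p' := projOf X N (p - mulV N⁻¹ q)
  have hNN : N * N⁻¹ = 1 :=
    Matrix.mul_nonsing_inv N ((Matrix.isUnit_iff_isUnit_det N).1 hN.isUnit)
  have h1 : normSqOf N (p' - u) ≤
      normSqOf N (p - u) - 2 * inner ℝ q (p - u) + normSqOf N⁻¹ q := by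
    refine (normSqOf_projOf_sub_le hX hc hN.posSemidef _ hu).trans_eq ?_
    rw [show p - mulV N⁻¹ q - u = (p - u) - mulV N⁻¹ q by abel, normSqOf_sub hN.1 (p - u),
      inner_mulV_comm hN.1, normSqOf, normSqOf, normSqOf, mulV_mulV, hNN, mulV_one,
      real_inner_comm q (mulV N⁻¹ q)]
  have h2 : normSqOf N (p - u) = normSqOf M (p - u) + 2 * η ^ 2 * (inner ℝ g (p - u) : ℝ) ^ 2 := by
    rw [hNdef, normSqOf_add_mat, normSqOf_smul_mat, normSqOf_outer]
  have hxu : (inner ℝ g (x - u) : ℝ) = inner ℝ g (p - u) - inner ℝ g (p - x) := by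
    rw [← inner_sub_right]; congr 1; abel
  have hxp' : (inner ℝ g (x - p) : ℝ) = -inner ℝ g (p - x) := by
    rw [← inner_neg_right, neg_sub]
  have h3 : lLoss η x g p - lLoss η x g u =
      inner ℝ q (p - u) - η ^ 2 * (inner ℝ g (p - u) : ℝ) ^ 2 := by
    rw [hq, lGrad, real_inner_smul_left, lLoss, lLoss, hxu, hxp']
    ring
  have h4 : normSqOf N⁻¹ q ≤ 2 * η ^ 2 * normSqOf N⁻¹ g := by
    rw [hq, lGrad, normSqOf_smul]
    refine mul_le_mul_of_nonneg_right ?_ (normSqOf_nonneg hN.inv.posSemidef g)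
    have h5 := abs_le.1 (abs_inner_le_mul hg hxp)
    have h6 : η * (inner ℝ g (p - x) : ℝ) ≤ 1 / 5 :=
      (mul_le_mul_of_nonneg_left h5.2 hη.le).trans hη5
    have h7 : -(1 / 5) ≤ η * (inner ℝ g (p - x) : ℝ) := by
      have := mul_le_mul_of_nonneg_left h5.1 hη.le
      linarith
    have h8 : (1 + 2 * (η * (inner ℝ g (p - x) : ℝ))) ^ 2 ≤ 2 := by nlinarith
    calc (η * (1 + 2 * η * (inner ℝ g (p - x) : ℝ))) ^ 2
        = η ^ 2 * (1 + 2 * (η * (inner ℝ g (p - x) : ℝ))) ^ 2 := by ring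
      _ ≤ η ^ 2 * 2 := mul_le_mul_of_nonneg_left h8 (sq_nonneg η)
      _ = 2 * η ^ 2 := mul_comm _ _
  linarith

/-! ### MetaGrad -/

section

variable {x₀ : Vec d} {G D : ℝ} {T : ℕ} {f : ℕ → Loss d}

/-- The state of MetaGrad before round `t`. -/
noncomputable def metaRun (X : Set (Vec d)) (x₀ : Vec d) (G D : ℝ) (T : ℕ) (f : ℕ → Loss d)
    (t : ℕ) : MetaGradState d := (metaGrad X x₀ G D T).state f t

local notation "gstate" => metaRun X x₀ G D T f
local notation "gaction" => OnlineAlgorithm.action (metaGrad X x₀ G D T) f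

lemma metaGrad_state_succ (t : ℕ) : gstate (t + 1) =
    metaGradStep X G D T (gstate t) (gaction t) ((f t).grad (gaction t)) := rfl

lemma metaGrad_action_eq_tiltedMean (t : ℕ) : gaction t =
    tiltedMean (gridIdx T) (gstate t).weight (gridRate G D) (gstate t).pt := rfl

lemma metaGrad_pt_mem (hX : IsCompact X) (hx₀ : x₀ ∈ X) (t i : ℕ) : (gstate t).pt i ∈ X := by
  cases t with
  | zero => exact hx₀
  | succ t => exact (projOf_spec hX ⟨_, hx₀⟩ _ _).1

lemma metaGrad_weight_pos (t i : ℕ) : 0 < (gstate t).weight i := by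
  induction t generalizing i with
  | zero => exact gridPrior_pos T i
  | succ t ih =>
    exact div_pos (mul_pos (ih i) (Real.exp_pos _))
      (Finset.sum_pos (fun j _ => mul_pos (ih j) (Real.exp_pos _)) (gridIdx_nonempty T))

lemma metaGrad_sum_weight (t : ℕ) : ∑ i ∈ gridIdx T, (gstate t).weight i = 1 := by
  cases t with
  | zero => exact sum_gridPrior T
  | succ t =>
    simp only [metaGrad_state_succ, metaGradStep]
    rw [← Finset.sum_div]
    exact div_self (Finset.sum_pos (fun j _ => mul_pos (metaGrad_weight_pos t j)
      (Real.exp_pos _)) (gridIdx_nonempty T)).ne'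

lemma metaGrad_action_mem (hf : IsInstance X G D T f) (hx₀ : x₀ ∈ X) (t : ℕ) :
    gaction t ∈ X := by
  rw [metaGrad_action_eq_tiltedMean]
  exact tiltedMean_mem hf.convex (fun i _ => metaGrad_weight_pos t i)
    (fun i _ => gridRate_pos hf.G_pos hf.D_pos i) (gridIdx_nonempty T)
    (fun i _ => metaGrad_pt_mem hf.isCompact hx₀ t i)

/-- The normalization of each round is at most `1`, so it only increases the weights. -/
lemma metaGrad_prior_mul_exp_le (hf : IsInstance X G D T f) (hx₀ : x₀ ∈ X) (i : ℕ) {t : ℕ}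
    (ht : t ≤ T) :
    gridPrior T i * Real.exp (-∑ r ∈ Finset.range t, lLoss (gridRate G D i) (gaction r)
      ((f r).grad (gaction r)) ((gstate r).pt i)) ≤ (gstate t).weight i := by
  have hG := hf.G_pos
  have hD := hf.D_pos
  induction t with
  | zero => simp [metaRun, OnlineAlgorithm.state, metaGrad]
  | succ t ih =>
    have hx := metaGrad_action_mem hf hx₀ t
    have hg := hf.grad_le t (by omega) _ hx
    have hmem := fun j => metaGrad_pt_mem (x₀ := x₀) (f := f) (T := T) (G := G) (D := D)
      hf.isCompact hx₀ t j
    have hZ : ∑ j ∈ gridIdx T, (gstate t).weight j * Real.exp (-lLoss (gridRate G D j)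
        (gaction t) ((f t).grad (gaction t)) ((gstate t).pt j)) ≤ 1 := by
      rw [← metaGrad_sum_weight (X := X) (x₀ := x₀) (G := G) (D := D) (f := f) t]
      have key := sum_mul_exp_neg_le_of_tiltedMean (s := gridIdx T)
        (w := (gstate t).weight) (η := gridRate G D) (p := (gstate t).pt)
        (fun j => lLoss (gridRate G D j) (gaction t) ((f t).grad (gaction t)) ((gstate t).pt j))
        ((f t).grad (gaction t)) (fun j _ => metaGrad_weight_pos t j)
        (fun j _ => gridRate_pos hG hD j) (gridIdx_nonempty T)
      rw [← metaGrad_action_eq_tiltedMean] at key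
      refine key fun j _ => exp_neg_le_one_add_inner (gridRate_pos hG hD j)
        ((gridRate_mul_le hG hD j).trans (by norm_num)) hg (hf.diam_le _ hx _ (hmem j)) ?_
      simp only [lLoss, mul_pow, neg_mul, le_refl]
    have hZ0 : 0 < ∑ j ∈ gridIdx T, (gstate t).weight j * Real.exp (-lLoss (gridRate G D j)
        (gaction t) ((f t).grad (gaction t)) ((gstate t).pt j)) :=
      Finset.sum_pos (fun j _ => mul_pos (metaGrad_weight_pos t j) (Real.exp_pos _))
        (gridIdx_nonempty T)
    have hstep : (gstate (t + 1)).weight i = (gstate t).weight i * Real.exp (-lLoss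
        (gridRate G D i) (gaction t) ((f t).grad (gaction t)) ((gstate t).pt i)) /
        ∑ j ∈ gridIdx T, (gstate t).weight j * Real.exp (-lLoss (gridRate G D j)
        (gaction t) ((f t).grad (gaction t)) ((gstate t).pt j)) := rfl
    rw [Finset.sum_range_succ, neg_add, Real.exp_add, ← mul_assoc, hstep]
    refine (mul_le_mul_of_nonneg_right (ih (by omega)) (Real.exp_pos _).le).trans ?_
    exact le_div_self (mul_pos (metaGrad_weight_pos t i) (Real.exp_pos _)).le hZ0 hZ

lemma metaGrad_neg_sum_lLoss_le (hf : IsInstance X G D T f) (hx₀ : x₀ ∈ X) (hT : 2 ≤ T) {i : ℕ}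
    (hi : i ∈ gridIdx T) :
    -∑ r ∈ Finset.range T, lLoss (gridRate G D i) (gaction r)
      ((f r).grad (gaction r)) ((gstate r).pt i) ≤ 6 * Real.log (T : ℝ) := by
  have hp := gridPrior_pos T i
  have h1 : (gstate T).weight i ≤ 1 := by
    rw [← metaGrad_sum_weight (X := X) (x₀ := x₀) (G := G) (D := D) (f := f) T]
    exact Finset.single_le_sum (fun j _ => (metaGrad_weight_pos T j).le) hi
  have h2 := Real.log_le_log (mul_pos hp (Real.exp_pos _))
    ((metaGrad_prior_mul_exp_le hf hx₀ i le_rfl).trans h1)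
  rw [Real.log_mul hp.ne' (Real.exp_pos _).ne', Real.log_exp, Real.log_one] at h2
  have h3 := neg_log_gridPrior_le hT hi
  have h4 := Real.log_le_log (div_pos hp (by norm_num))
    (show gridPrior T i / 3 ≤ gridPrior T i by linarith)
  linarith

lemma metaGrad_gram_posSemidef (t : ℕ) : (gstate t).gram.PosSemidef := by
  induction t with
  | zero => exact Matrix.PosSemidef.zero
  | succ t ih => exact ih.add (posSemidef_outer _)

lemma metaGrad_trace_gram_le (hf : IsInstance X G D T f) (hx₀ : x₀ ∈ X) {t : ℕ} (ht : t ≤ T) :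
    (gstate t).gram.trace ≤ t * G ^ 2 := by
  induction t with
  | zero => simp [metaRun, OnlineAlgorithm.state, metaGrad]
  | succ t ih =>
    have h1 : (gstate (t + 1)).gram = (gstate t).gram + outer ((f t).grad (gaction t)) := rfl
    have h2 := pow_le_pow_left₀ (norm_nonneg _)
      (hf.grad_le t (by omega) _ (metaGrad_action_mem hf hx₀ t)) 2
    have h3 := ih (by omega)
    rw [h1, Matrix.trace_add, trace_outer]
    push_cast
    linarith

/-- Regret of a slave: the Newton steps telescope, with `‖x₀ - u‖² / D² ≤ 1` at the start. -/
lemma metaGrad_two_mul_sum_lLoss_sub_le (hf : IsInstance X G D T f) (hx₀ : x₀ ∈ X) (i : ℕ)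
    {u : Vec d} (hu : u ∈ X) {t : ℕ} (ht : t ≤ T) :
    2 * ∑ r ∈ Finset.range t,
      (lLoss (gridRate G D i) (gaction r) ((f r).grad (gaction r)) ((gstate r).pt i) -
        lLoss (gridRate G D i) (gaction r) ((f r).grad (gaction r)) u) ≤
      1 - normSqOf (newtonMat D (gridRate G D i) (gstate t).gram) ((gstate t).pt i - u) +
      (Real.log (newtonMat D (gridRate G D i) (gstate t).gram).det -
        Real.log (newtonMat D (gridRate G D i) (0 : Matrix (Fin d) (Fin d) ℝ)).det) := by
  have hG := hf.G_pos
  have hD := hf.D_pos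
  induction t with
  | zero =>
    have h1 : (gstate 0).gram = 0 := rfl
    have h2 : (gstate 0).pt i = x₀ := rfl
    rw [h1, h2, newtonMat, smul_zero, add_zero, normSqOf_smul_mat, normSqOf_one]
    have h3 := pow_le_pow_left₀ (norm_nonneg _) (hf.diam_le _ hx₀ _ hu) 2
    have h4 : 1 / D ^ 2 * ‖x₀ - u‖ ^ 2 ≤ 1 := by
      rw [one_div, inv_mul_le_iff₀ (by positivity)]
      linarith
    simp only [Finset.range_zero, Finset.sum_empty, mul_zero]
    linarith
  | succ t ih =>
    have hx := metaGrad_action_mem hf hx₀ t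
    have hp := metaGrad_pt_mem (x₀ := x₀) (f := f) (T := T) (G := G) (D := D)
      hf.isCompact hx₀ t i
    have hS := metaGrad_gram_posSemidef (X := X) (x₀ := x₀) (f := f) (T := T) (G := G) (D := D) t
    have hS' := metaGrad_gram_posSemidef (X := X) (x₀ := x₀) (f := f) (T := T) (G := G) (D := D)
      (t + 1)
    have hgram : (gstate (t + 1)).gram = (gstate t).gram + outer ((f t).grad (gaction t)) := rfl
    have hpt : (gstate (t + 1)).pt i =
        projOf X (metaGradSigma D (gridRate G D i) (gstate (t + 1)).gram)⁻¹
          ((gstate t).pt i - mulV (metaGradSigma D (gridRate G D i) (gstate (t + 1)).gram)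
            (lGrad (gridRate G D i) (gaction t) ((f t).grad (gaction t)) ((gstate t).pt i))) := rfl
    have hsig : metaGradSigma D (gridRate G D i) (gstate (t + 1)).gram =
        (newtonMat D (gridRate G D i) (gstate (t + 1)).gram)⁻¹ := rfl
    rw [metaGradSigma_inv hD hS', hsig] at hpt
    have hN := posDef_newtonMat (η := gridRate G D i) hD hS'
    have hstep := two_mul_lLoss_sub_le hf.isCompact hf.convex
      (gridRate_pos hG hD i) (gridRate_mul_le hG hD i) (hf.grad_le t (by omega) _ hx)
      (hf.diam_le _ hp _ hx) hu (posDef_newtonMat (η := gridRate G D i) hD hS)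
      (by rw [← newtonMat_add_outer, ← hgram]; exact hN)
    rw [← newtonMat_add_outer, ← hgram, ← hpt] at hstep
    have ih' := ih (by omega)
    rw [Finset.sum_range_succ, mul_add]
    linarith

/-- The second-order bound of MetaGrad,
`∑ ⟪g_t, x_t - u⟫ = O(√(d log T ∑ G² ‖x_t - u‖²) + G D d log T)`. -/
lemma metaGrad_second_order (hf : IsInstance X G D T f) (hx₀ : x₀ ∈ X) (hT : 2 ≤ T)
    (hd : 1 ≤ d) {u : Vec d} (hu : u ∈ X) :
    ∑ t ∈ Finset.range T, (inner ℝ ((f t).grad (gaction t)) (gaction t - u) : ℝ) ≤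
      9 * √(d * Real.log (T : ℝ) * (G ^ 2 * ∑ t ∈ Finset.range T, ‖gaction t - u‖ ^ 2)) +
        80 * (G * D * (d * Real.log (T : ℝ))) := by
  have hG := hf.G_pos
  have hD := hf.D_pos
  have hlog := half_le_log hT
  have hd1 : (1 : ℝ) ≤ d := by exact_mod_cast hd
  have hdlog : Real.log (T : ℝ) ≤ d * Real.log (T : ℝ) :=
    le_mul_of_one_le_left (by linarith) hd1
  set V := ∑ t ∈ Finset.range T,
    (inner ℝ ((f t).grad (gaction t)) (gaction t - u) : ℝ) ^ 2 with hVdef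
  have hV0 : 0 ≤ V := Finset.sum_nonneg fun t _ => sq_nonneg _
  have hV : V ≤ G ^ 2 * D ^ 2 * T := by
    calc V ≤ ∑ t ∈ Finset.range T, (G * D) ^ 2 := by
          refine Finset.sum_le_sum fun t ht => ?_
          have hx := metaGrad_action_mem hf hx₀ t
          have := pow_le_pow_left₀ (abs_nonneg _) (abs_inner_le_mul
            (hf.grad_le t (Finset.mem_range.1 ht) _ hx) (hf.diam_le _ hx _ hu)) 2
          rwa [sq_abs] at this
      _ = G ^ 2 * D ^ 2 * T := by simp; ring
  have hVW : V ≤ G ^ 2 * ∑ t ∈ Finset.range T, ‖gaction t - u‖ ^ 2 := by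
    rw [Finset.mul_sum]
    refine Finset.sum_le_sum fun t ht => ?_
    have hg := hf.grad_le t (Finset.mem_range.1 ht) _ (metaGrad_action_mem hf hx₀ t)
    have := pow_le_pow_left₀ (abs_nonneg _) ((abs_real_inner_le_norm _ _).trans
      (mul_le_mul_of_nonneg_right hg (norm_nonneg (gaction t - u)))) 2
    rwa [sq_abs, mul_pow] at this
  refine (le_of_forall_gridRate (A := 8 * (d * Real.log (T : ℝ))) hT hG hD hV0 hV (by linarith)
    fun i hi => ?_).trans ?_
  · have h1 := metaGrad_neg_sum_lLoss_le hf hx₀ hT hi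
    have h2 := metaGrad_two_mul_sum_lLoss_sub_le hf hx₀ i hu le_rfl
    have hS := metaGrad_gram_posSemidef (X := X) (x₀ := x₀) (f := f) (T := T) (G := G) (D := D) T
    have h3 := log_det_newtonMat_sub_le hD hG (gridRate_pos hG hD i) (gridRate_mul_le hG hD i) hS
      (metaGrad_trace_gram_le hf hx₀ le_rfl)
    have h4 := normSqOf_nonneg (posDef_newtonMat (η := gridRate G D i) hD hS).posSemidef
      ((gstate T).pt i - u)
    have h5 := mul_le_mul_of_nonneg_left (log_one_add_le hT) (Nat.cast_nonneg (α := ℝ) d)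
    have h6 : ∑ r ∈ Finset.range T,
        lLoss (gridRate G D i) (gaction r) ((f r).grad (gaction r)) u =
        -(gridRate G D i * ∑ t ∈ Finset.range T,
            (inner ℝ ((f t).grad (gaction t)) (gaction t - u) : ℝ)) +
          gridRate G D i ^ 2 * V := by
      simp only [lLoss, Finset.sum_add_distrib, Finset.mul_sum, neg_mul, Finset.sum_neg_distrib,
        hVdef]
    rw [Finset.sum_sub_distrib] at h2
    linarith
  · have h9 : 3 * √(8 * (d * Real.log (T : ℝ)) * V) ≤ 9 * √(d * Real.log (T : ℝ) *
        (G ^ 2 * ∑ t ∈ Finset.range T, ‖gaction t - u‖ ^ 2)) := by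
      rw [mul_assoc 8, Real.sqrt_mul (by norm_num)]
      have h8 : √(8 : ℝ) ≤ 3 := by rw [Real.sqrt_le_left (by norm_num)]; norm_num
      have h10 : √(d * Real.log (T : ℝ) * V) ≤ √(d * Real.log (T : ℝ) *
          (G ^ 2 * ∑ t ∈ Finset.range T, ‖gaction t - u‖ ^ 2)) :=
        Real.sqrt_le_sqrt (mul_le_mul_of_nonneg_left hVW (by linarith))
      have := mul_le_mul h8 h10 (Real.sqrt_nonneg _) (by norm_num)
      linarith
    linarith

lemma metaGrad_sum_sub_le {k : ℕ} {lam : ℝ} (hf : IsInstance X G D T f) (hx₀ : x₀ ∈ X)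
    (hT : 2 ≤ T) (hlam : 0 < lam) (hcont : IsContaminated T k (Loss.IsStronglyConvex X lam) f)
    {u : Vec d} (hu : u ∈ X) :
    ∑ t ∈ Finset.range T, ((f t).val (gaction t) - (f t).val u) ≤
      (9 ^ 2 / 2 + 9 + 80) * regretBound G D lam k T d := by
  have hlog := half_le_log hT
  rcases Nat.eq_zero_or_pos d with hd | hd
  · -- In dimension `0` there is a single point.
    have : Subsingleton (Vec d) := by subst hd; infer_instance
    have h0 : ∀ t, gaction t = u := fun t => Subsingleton.elim _ _
    simp only [h0, sub_self, Finset.sum_const_zero]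
    exact mul_nonneg (by norm_num)
      (regretBound_nonneg k hf.G_pos hf.D_pos hlam hT (Nat.cast_nonneg _))
  · have h := sum_sub_le_of_second_order hf hlam hcont
      (fun t _ => metaGrad_action_mem hf hx₀ t) (fun t _ => hu) (by norm_num) (by norm_num)
      (by positivity) (metaGrad_second_order hf hx₀ hT hd hu)
    simpa only [regretBound, mul_assoc] using h

end

/-! ### Adapt-ML-Prod -/

/-- Changing the exponent of a weight costs little: `x ≤ x ^ a + (a - 1)` for `a ≥ 1`. -/
lemma le_rpow_add_sub_one {x a : ℝ} (hx : 0 < x) (ha : 1 ≤ a) : x ≤ x ^ a + (a - 1) := by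
  rcases le_total 1 x with h | h
  · have := Real.rpow_le_rpow_of_exponent_le h ha
    rw [Real.rpow_one] at this
    linarith
  · -- `x - x ^ a ≤ -x log x · (a - 1) ≤ a - 1`.
    have h1 : x ^ a = x * Real.exp (Real.log x * (a - 1)) := by
      rw [Real.rpow_def_of_pos hx, show Real.log x * a = Real.log x + Real.log x * (a - 1) by ring,
        Real.exp_add, Real.exp_log hx]
    have h2 := Real.add_one_le_exp (Real.log x * (a - 1))
    have h3 : -1 ≤ x * Real.log x := by
      have := Real.one_sub_inv_le_log_of_pos hx
      have h4 := mul_le_mul_of_nonneg_left this hx.le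
      rw [mul_sub, mul_inv_cancel₀ hx.ne'] at h4
      linarith
    have h5 := mul_le_mul_of_nonneg_left h2 hx.le
    have h6 := mul_le_mul_of_nonneg_right h3 (sub_nonneg.2 ha)
    rw [h1]
    linarith

lemma uscRate_pos {K : ℕ} (hK : 2 ≤ K) {v : ℝ} (hv : 0 ≤ v) : 0 < uscRate K v := by
  have : 0 < Real.log (K : ℝ) := Real.log_pos (by exact_mod_cast hK)
  unfold uscRate
  exact lt_min (by norm_num) (Real.sqrt_pos.2 (by positivity))

lemma uscRate_le_half (K : ℕ) (v : ℝ) : uscRate K v ≤ 1 / 2 := min_le_left _ _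

lemma uscRate_anti {K : ℕ} (hK : 2 ≤ K) {v v' : ℝ} (hv : 0 ≤ v) (hvv' : v ≤ v') :
    uscRate K v' ≤ uscRate K v := by
  have : 0 < Real.log (K : ℝ) := Real.log_pos (by exact_mod_cast hK)
  unfold uscRate
  gcongr

/-- The total exponent change of one weight is at most logarithmic: one step costs at most the
increment of `log (1 + v)`. -/
lemma uscRate_div_sub_one_le {K : ℕ} (hK : 2 ≤ K) {v ρ : ℝ} (hv : 0 ≤ v) (hρ : |ρ| ≤ 1 / 2) :
    uscRate K v / uscRate K (v + ρ ^ 2) - 1 ≤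
      Real.log (1 + (v + ρ ^ 2)) - Real.log (1 + v) := by
  have hL : 0 < Real.log (K : ℝ) := Real.log_pos (by exact_mod_cast hK)
  have hρ2 : ρ ^ 2 ≤ 1 / 4 := by
    have := pow_le_pow_left₀ (abs_nonneg ρ) hρ 2
    rw [sq_abs] at this; linarith
  have hρ0 := sq_nonneg ρ
  have hv' : 0 ≤ v + ρ ^ 2 := by positivity
  set q := (1 + (v + ρ ^ 2)) / (1 + v) with hq
  have hq1 : 1 ≤ q := by rw [hq, one_le_div (by linarith)]; linarith
  have hq2 : q ≤ 2 := by rw [hq, div_le_iff₀ (by linarith)]; linarith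
  have hpos := uscRate_pos hK hv'
  have hratio : uscRate K v ≤ √q * uscRate K (v + ρ ^ 2) := by
    have hsq1 : 1 ≤ √q := Real.one_le_sqrt.2 hq1
    unfold uscRate
    rw [mul_min_of_nonneg _ _ (Real.sqrt_nonneg q), ← Real.sqrt_mul (by linarith)]
    refine min_le_min (by linarith) (Real.sqrt_le_sqrt (le_of_eq ?_))
    rw [hq]; field_simp
  have h1 : uscRate K v / uscRate K (v + ρ ^ 2) ≤ √q := (div_le_iff₀ hpos).2 hratio
  have h2 : √q ≤ 1 + (q - 1) / 2 := by
    have := Real.sqrt_one_add_le (x := q - 1) (by linarith)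
    rwa [show 1 + (q - 1) = q by ring] at this
  have h3 : (q - 1) / 2 ≤ Real.log q := by
    refine le_trans ?_ (Real.one_sub_inv_le_log_of_pos (by linarith : 0 < q))
    have hqi : q * q⁻¹ = 1 := mul_inv_cancel₀ (by linarith)
    have hqi2 : 1 / 2 ≤ q⁻¹ := by
      rw [one_div]; exact inv_anti₀ (by linarith) hq2
    nlinarith
  rw [hq, Real.log_div (by linarith) (by linarith)] at h3
  linarith

/-- One step of the self-confident sum `∑ ρ² / √(1 + v)`, which telescopes to `O(√(1 + v))`. -/
lemma uscRate_mul_sq_le {K : ℕ} {v ρ : ℝ} (hv : 0 ≤ v) (hρ : |ρ| ≤ 1 / 2) :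
    uscRate K v * ρ ^ 2 ≤ 3 * √(Real.log (K : ℝ)) * (√(1 + (v + ρ ^ 2)) - √(1 + v)) := by
  have hρ2 : ρ ^ 2 ≤ 1 / 4 := by
    have := pow_le_pow_left₀ (abs_nonneg ρ) hρ 2
    rw [sq_abs] at this; linarith
  have hρ0 := sq_nonneg ρ
  set a := √(1 + v) with ha
  set b := √(1 + (v + ρ ^ 2)) with hb
  have ha2 : a ^ 2 = 1 + v := Real.sq_sqrt (by linarith)
  have hb2 : b ^ 2 = 1 + (v + ρ ^ 2) := Real.sq_sqrt (by linarith)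
  have ha0 : 0 < a := Real.sqrt_pos.2 (by linarith)
  have hab : a ≤ b := Real.sqrt_le_sqrt (by linarith)
  have hb2a : b ≤ 2 * a := by
    refine abs_le_of_sq_le_sq' ?_ (by positivity) |>.2
    nlinarith
  have hrate : uscRate K v ≤ √(Real.log (K : ℝ)) / a := by
    rw [ha, ← Real.sqrt_div' _ (by linarith)]
    exact min_le_right _ _
  have h1 : ρ ^ 2 / a ≤ 3 * (b - a) := by
    rw [div_le_iff₀ ha0]
    nlinarith
  calc uscRate K v * ρ ^ 2 ≤ √(Real.log (K : ℝ)) / a * ρ ^ 2 :=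
        mul_le_mul_of_nonneg_right hrate hρ0
    _ = √(Real.log (K : ℝ)) * (ρ ^ 2 / a) := by ring
    _ ≤ √(Real.log (K : ℝ)) * (3 * (b - a)) :=
        mul_le_mul_of_nonneg_left h1 (Real.sqrt_nonneg _)
    _ = _ := by ring

lemma inv_uscRate_le {K : ℕ} (hK : 2 ≤ K) {v : ℝ} (hv : 0 ≤ v) :
    1 / uscRate K v ≤ 2 + √(1 + v) / √(Real.log (K : ℝ)) := by
  have hL : 0 < Real.log (K : ℝ) := Real.log_pos (by exact_mod_cast hK)
  have h0 : 0 ≤ √(1 + v) / √(Real.log (K : ℝ)) := by positivity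
  unfold uscRate
  rcases min_choice (1 / 2 : ℝ) √(Real.log (K : ℝ) / (1 + v)) with h | h <;> rw [h]
  · norm_num; exact h0
  · rw [Real.sqrt_div hL.le, one_div_div]
    linarith

section AdaptMLProd

variable {ι : Type} [Fintype ι] {T : ℕ} {r w v : ℕ → ι → ℝ}

/-- The sum of the weights of Adapt-ML-Prod stays below `1 + K log (1 + T)`. -/
lemma adaptMLProd_sum_weight_le (hK : 2 ≤ Fintype.card ι)
    (hv0 : ∀ i, v 0 i = 0) (hv : ∀ t i, v (t + 1) i = v t i + r t i ^ 2)
    (hw0 : ∀ i, w 0 i = 1 / (Fintype.card ι : ℝ))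
    (hw : ∀ t i, w (t + 1) i = (w t i * (1 + uscRate (Fintype.card ι) (v t i) * r t i)) ^
      (uscRate (Fintype.card ι) (v t i + r t i ^ 2) / uscRate (Fintype.card ι) (v t i)))
    (hwpos : ∀ t ≤ T, ∀ i, 0 < w t i) (hr : ∀ t < T, ∀ i, |r t i| ≤ 1 / 2)
    (hmix : ∀ t < T, ∑ i, uscRate (Fintype.card ι) (v t i) * w t i * r t i = 0) :
    ∑ i, w T i ≤ 1 + Fintype.card ι * Real.log (1 + (T : ℝ)) := by
  have hvn : ∀ t i, 0 ≤ v t i := by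
    intro t i
    induction t with
    | zero => rw [hv0]
    | succ t ih => rw [hv]; positivity
  have hvT : ∀ t ≤ T, ∀ i, v t i ≤ t := by
    intro t ht i
    induction t with
    | zero => simp [hv0]
    | succ t ih =>
      have h1 := hr t (by omega) i
      have h2 := pow_le_pow_left₀ (abs_nonneg _) h1 2
      rw [sq_abs] at h2
      have h3 := ih (by omega)
      rw [hv]
      push_cast
      linarith
  have hsum : ∀ t ≤ T, ∑ i, w t i ≤ 1 + ∑ i, Real.log (1 + v t i) := by
    intro t ht
    induction t with
    | zero =>
      have : (Fintype.card ι : ℝ) ≠ 0 := by positivity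
      simp [hw0, hv0, this]
    | succ t ih =>
      have hstep : ∀ i, w (t + 1) i ≤ w t i + uscRate (Fintype.card ι) (v t i) * w t i * r t i +
          (Real.log (1 + v (t + 1) i) - Real.log (1 + v t i)) := by
        intro i
        have hη := uscRate_pos hK (hvn t i)
        have hη' : 0 < uscRate (Fintype.card ι) (v t i + r t i ^ 2) :=
          uscRate_pos hK (by have := hvn t i; positivity)
        have hanti := uscRate_anti hK (hvn t i) (le_add_of_nonneg_right (sq_nonneg (r t i)))
        have hri := abs_le.1 (hr t (by omega) i)
        have hbase : 0 < w t i * (1 + uscRate (Fintype.card ι) (v t i) * r t i) := by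
          refine mul_pos (hwpos t (by omega) i) ?_
          have := uscRate_le_half (Fintype.card ι) (v t i)
          nlinarith
        have h1 := le_rpow_add_sub_one (hwpos (t + 1) ht i) ((one_le_div hη').2 hanti)
        have h2 := uscRate_div_sub_one_le hK (hvn t i) (hr t (by omega) i)
        nth_rewrite 2 [hw] at h1
        rw [← Real.rpow_mul hbase.le, div_mul_div_comm, mul_comm
          (uscRate (Fintype.card ι) (v t i + r t i ^ 2)), div_self (by positivity),
          Real.rpow_one] at h1
        rw [hv t i]
        linarith
      refine (Finset.sum_le_sum fun i _ => hstep i).trans ?_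
      rw [Finset.sum_add_distrib, Finset.sum_add_distrib, Finset.sum_sub_distrib,
        hmix t (by omega)]
      linarith [ih (by omega)]
  refine (hsum T le_rfl).trans ?_
  have : ∑ i, Real.log (1 + v T i) ≤ ∑ _i : ι, Real.log (1 + (T : ℝ)) :=
    Finset.sum_le_sum fun i _ => Real.log_le_log (by linarith [hvn T i])
      (by linarith [hvT T le_rfl i])
  simp only [Finset.sum_const, Finset.card_univ, nsmul_eq_mul] at this
  linarith

/-- The second-order regret bound of Adapt-ML-Prod, with gaps `r`, weights `w` and sums of squared
gaps `v`. It follows from comparing `log (w t i) / η t i`, whose increments are at least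
`r t i - η t i * r t i ^ 2`, with the sum of all weights. -/
lemma adaptMLProd_sum_le (hK : 2 ≤ Fintype.card ι)
    (hv0 : ∀ i, v 0 i = 0) (hv : ∀ t i, v (t + 1) i = v t i + r t i ^ 2)
    (hw0 : ∀ i, w 0 i = 1 / (Fintype.card ι : ℝ))
    (hw : ∀ t i, w (t + 1) i = (w t i * (1 + uscRate (Fintype.card ι) (v t i) * r t i)) ^
      (uscRate (Fintype.card ι) (v t i + r t i ^ 2) / uscRate (Fintype.card ι) (v t i)))
    (hwpos : ∀ t ≤ T, ∀ i, 0 < w t i) (hr : ∀ t < T, ∀ i, |r t i| ≤ 1 / 2)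
    (hmix : ∀ t < T, ∑ i, uscRate (Fintype.card ι) (v t i) * w t i * r t i = 0) (i : ι) :
    ∑ t ∈ Finset.range T, r t i ≤
      2 * Real.log (Fintype.card ι : ℝ) + √(Real.log (Fintype.card ι : ℝ)) +
      3 * √(Real.log (Fintype.card ι : ℝ)) * √(1 + v T i) +
      Real.log (1 + Fintype.card ι * Real.log (1 + (T : ℝ))) *
        (2 + √(1 + v T i) / √(Real.log (Fintype.card ι : ℝ))) := by
  have hvn : ∀ t, 0 ≤ v t i := by
    intro t
    induction t with
    | zero => rw [hv0]
    | succ t ih => rw [hv]; positivity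
  have hlogK : 0 < Real.log (Fintype.card ι : ℝ) := Real.log_pos (by exact_mod_cast hK)
  set L := Real.log (Fintype.card ι : ℝ) with hL
  have hpot : ∀ t ≤ T, ∑ s ∈ Finset.range t, r s i ≤
      L * (1 / uscRate (Fintype.card ι) (v 0 i)) +
      3 * √L * (√(1 + v t i) - √(1 + v 0 i)) +
      Real.log (w t i) / uscRate (Fintype.card ι) (v t i) := by
    intro t ht
    induction t with
    | zero =>
      have : Real.log (w 0 i) = -L := by rw [hw0, one_div, Real.log_inv]
      rw [this]
      simp only [Finset.range_zero, Finset.sum_empty, sub_self, mul_zero, add_zero]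
      exact le_of_eq (by ring)
    | succ t ih =>
      have hη := uscRate_pos hK (hvn t)
      have hη' : 0 < uscRate (Fintype.card ι) (v t i + r t i ^ 2) :=
        uscRate_pos hK (by have := hvn t; positivity)
      have hri := hr t (by omega) i
      have hri' := abs_le.1 hri
      have hηr : -(1 / 2) ≤ uscRate (Fintype.card ι) (v t i) * r t i := by
        have := uscRate_le_half (Fintype.card ι) (v t i)
        nlinarith
      have hfac : 0 < 1 + uscRate (Fintype.card ι) (v t i) * r t i := by linarith
      have hwt := hwpos t (by omega) i
      have h1 : Real.log (w (t + 1) i) / uscRate (Fintype.card ι) (v (t + 1) i) =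
          (Real.log (w t i) + Real.log (1 + uscRate (Fintype.card ι) (v t i) * r t i)) /
            uscRate (Fintype.card ι) (v t i) := by
        rw [hw, hv, Real.log_rpow (mul_pos hwt hfac), Real.log_mul hwt.ne' hfac.ne']
        field_simp
      have h2 : r t i - uscRate (Fintype.card ι) (v t i) * r t i ^ 2 ≤
          Real.log (1 + uscRate (Fintype.card ι) (v t i) * r t i) /
            uscRate (Fintype.card ι) (v t i) := by
        rw [le_div_iff₀ hη]
        have := sub_sq_le_log_one_add hηr
        linarith
      have h3 := uscRate_mul_sq_le (K := Fintype.card ι) (hvn t) hri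
      have h4 := ih (by omega)
      rw [h1, add_div, Finset.sum_range_succ, hv]
      linarith
  have h0 : 1 / uscRate (Fintype.card ι) (v 0 i) ≤ 2 + 1 / √L := by
    simpa [hv0] using inv_uscRate_le hK (hvn 0)
  have h0' : L * (1 / uscRate (Fintype.card ι) (v 0 i)) ≤ 2 * L + √L := by
    refine (mul_le_mul_of_nonneg_left h0 hlogK.le).trans_eq ?_
    rw [mul_add, mul_one_div, Real.div_sqrt]
    ring
  have hwT : Real.log (w T i) ≤ Real.log (1 + Fintype.card ι * Real.log (1 + (T : ℝ))) := by
    refine Real.log_le_log (hwpos T le_rfl i) ?_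
    refine (Finset.single_le_sum (f := fun j => w T j) (fun j _ => (hwpos T le_rfl j).le)
      (Finset.mem_univ i)).trans ?_
    exact adaptMLProd_sum_weight_le hK hv0 hv hw0 hw hwpos hr hmix
  have hlogT : 0 ≤ Real.log (1 + Fintype.card ι * Real.log (1 + (T : ℝ))) := by
    refine Real.log_nonneg ?_
    have : 0 ≤ Real.log (1 + (T : ℝ)) := Real.log_nonneg (by linarith [Nat.cast_nonneg (α := ℝ) T])
    have : 0 ≤ Fintype.card ι * Real.log (1 + (T : ℝ)) := by positivity
    linarith
  have hlast : Real.log (w T i) / uscRate (Fintype.card ι) (v T i) ≤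
      Real.log (1 + Fintype.card ι * Real.log (1 + (T : ℝ))) * (2 + √(1 + v T i) / √L) := by
    rw [div_eq_mul_one_div]
    exact mul_le_mul hwT (inv_uscRate_le hK (hvn T))
      (one_div_nonneg.2 (uscRate_pos hK (hvn T)).le) hlogT
  have h5 : 0 ≤ 3 * √L * √(1 + v 0 i) := by positivity
  linarith [hpot T le_rfl]

end AdaptMLProd

/-- For `K ≤ A log T` experts all logarithmic terms of the Adapt-ML-Prod bound are dominated by
`√(log T)`. -/
lemma adaptMLProd_bound_le {A q : ℝ} {T K : ℕ} (hA : 1 ≤ A) (hT : 2 ≤ T) (hK : 2 ≤ K)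
    (hKA : (K : ℝ) ≤ A * Real.log (T : ℝ)) (hq : 0 ≤ q) :
    2 * Real.log (K : ℝ) + √(Real.log (K : ℝ)) + 3 * √(Real.log (K : ℝ)) * √(1 + q) +
      Real.log (1 + K * Real.log (1 + (T : ℝ))) * (2 + √(1 + q) / √(Real.log (K : ℝ))) ≤
      19 * A * √(Real.log (T : ℝ) * q) + 60 * A * Real.log (T : ℝ) := by
  have hL := half_le_log hT
  have hLT := log_one_add_le hT
  set L := Real.log (T : ℝ)
  set s := √L with hs
  have hs2 : s ^ 2 = L := Real.sq_sqrt (by linarith)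
  have hs0 : 0 ≤ s := Real.sqrt_nonneg _
  have hsL : s ≤ 3 / 2 * L := by
    have : 2 / 3 ≤ s := Real.le_sqrt_of_sq_le (by norm_num; linarith)
    nlinarith
  have hK2 : (2 : ℝ) ≤ K := by exact_mod_cast hK
  have hlogK : Real.log (K : ℝ) ≤ A * L := (Real.log_le_self (by linarith)).trans hKA
  have hlogK' : 1 / 2 ≤ Real.log (K : ℝ) := half_le_log hK
  have hsK : √(Real.log (K : ℝ)) ≤ A * s := by
    rw [Real.sqrt_le_left (by positivity), mul_pow, hs2]
    nlinarith
  have hsK' : 1 / 2 ≤ √(Real.log (K : ℝ)) := Real.le_sqrt_of_sq_le (by norm_num; linarith)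
  have hsq : √(1 + q) ≤ 1 + √q := by simpa using sqrt_add_le zero_le_one hq
  have hq0 : 0 ≤ √q := Real.sqrt_nonneg q
  have hLT0 : 0 ≤ Real.log (1 + (T : ℝ)) :=
    Real.log_nonneg (by linarith [Nat.cast_nonneg (α := ℝ) T])
  have hKT : 0 ≤ K * Real.log (1 + (T : ℝ)) := by positivity
  have hLL : Real.log (1 + K * Real.log (1 + (T : ℝ))) ≤ 8 * A * s := by
    have h1 : 1 + K * Real.log (1 + (T : ℝ)) ≤ (1 + 2 * A * s) ^ 4 := by
      calc 1 + K * Real.log (1 + (T : ℝ)) ≤ 1 + (A * L) * (2 * L) := by gcongr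
        _ = 1 + 2 * A * s ^ 4 := by rw [← hs2]; ring
        _ ≤ 1 + (2 * A) ^ 4 * s ^ 4 := by
            gcongr
            exact le_self_pow₀ (by linarith) (by norm_num)
        _ ≤ (1 + 2 * A * s) ^ 4 := by
            have h0 : 0 ≤ 2 * A * s := by positivity
            rw [← mul_pow]
            nlinarith [pow_nonneg h0 2, pow_nonneg h0 3]
    have h0 : 0 ≤ 2 * A * s := by positivity
    have h2 := Real.log_le_log (by linarith) h1
    rw [Real.log_pow] at h2
    have h3 := Real.log_le_sub_one_of_pos (show 0 < 1 + 2 * A * s by linarith)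
    push_cast at h2
    linarith
  have hdiv : √(1 + q) / √(Real.log (K : ℝ)) ≤ 2 * (1 + √q) := by
    rw [div_le_iff₀ (by linarith)]
    nlinarith
  have hmul : √(L * q) = s * √q := Real.sqrt_mul (by linarith) q
  have e1 : √(Real.log (K : ℝ)) * √(1 + q) ≤ A * s * (1 + √q) :=
    mul_le_mul hsK hsq (Real.sqrt_nonneg _) (by positivity)
  have e2 : Real.log (1 + K * Real.log (1 + (T : ℝ))) * (2 + √(1 + q) / √(Real.log (K : ℝ))) ≤
      8 * A * s * (2 + 2 * (1 + √q)) := by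
    refine mul_le_mul hLL (by linarith) (by positivity) (by positivity)
  have e3 : A * s ≤ A * (3 / 2 * L) := mul_le_mul_of_nonneg_left hsL (by linarith)
  have e4 : 0 ≤ A * L := by positivity
  rw [hmul]
  linarith

/-! ### USC -/

section

variable {ι : Type} [Fintype ι] {experts : ι → OnlineAlgorithm d} {G D : ℝ} {T : ℕ}
  {f : ℕ → Loss d}

/-- The state of USC before round `t`. -/
noncomputable def uscRun (experts : ι → OnlineAlgorithm d) (G D : ℝ) (f : ℕ → Loss d) (t : ℕ) :
    USCState experts := (usc experts G D).state f t

local notation "ustate" => uscRun experts G D f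
local notation "uaction" => OnlineAlgorithm.action (usc experts G D) f

lemma usc_expert (t : ℕ) (i : ι) : (ustate t).expert i = (experts i).state f t := by
  induction t with
  | zero => rfl
  | succ t ih =>
    have h : (ustate (t + 1)).expert i = (experts i).update ((ustate t).expert i) (f t) := rfl
    rw [h, ih]
    rfl

lemma usc_sq_nonneg (t : ℕ) (i : ι) : 0 ≤ (ustate t).sq i := by
  induction t with
  | zero => exact le_rfl
  | succ t ih => exact add_nonneg ih (sq_nonneg _)

lemma usc_action_eq (t : ℕ) :
    uaction t = ∑ i, uscProb (ustate t) i • (experts i).action f t := by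
  change ∑ i, uscProb (ustate t) i • (experts i).play ((ustate t).expert i) = _
  exact Finset.sum_congr rfl fun i _ => by rw [usc_expert]; rfl

lemma usc_sum_rate_pos (hK : 2 ≤ Fintype.card ι) {t : ℕ} (hw : ∀ i, 0 < (ustate t).w i) :
    0 < ∑ j, uscRate (Fintype.card ι) ((ustate t).sq j) * (ustate t).w j := by
  have : Nonempty ι := Fintype.card_pos_iff.1 (by omega)
  exact Finset.sum_pos (fun j _ => mul_pos (uscRate_pos hK (usc_sq_nonneg t j)) (hw j))
    Finset.univ_nonempty

lemma usc_sum_prob (hK : 2 ≤ Fintype.card ι) {t : ℕ} (hw : ∀ i, 0 < (ustate t).w i) :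
    ∑ i, uscProb (ustate t) i = 1 := by
  simp only [uscProb]
  rw [← Finset.sum_div, div_self (usc_sum_rate_pos hK hw).ne']

lemma usc_action_mem_of_weight_pos (hX : Convex ℝ X) (hK : 2 ≤ Fintype.card ι) {t : ℕ}
    (hw : ∀ i, 0 < (ustate t).w i) (hmem : ∀ i, (experts i).action f t ∈ X) : uaction t ∈ X := by
  rw [usc_action_eq]
  refine hX.sum_mem (fun i _ => ?_) (usc_sum_prob hK hw) (fun i _ => hmem i)
  exact div_nonneg (mul_pos (uscRate_pos hK (usc_sq_nonneg t i)) (hw i)).le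
    (usc_sum_rate_pos hK hw).le

/-- The master's normalized loss is the constant `1/2`, so the gap is a normalized linear one. -/
lemma usc_gap_eq (hG : 0 < G) (hD : 0 < D) (hK : 2 ≤ Fintype.card ι) {t : ℕ}
    (hw : ∀ i, 0 < (ustate t).w i) (i : ι) :
    uscGap G D (ustate t) (f t) i =
      inner ℝ ((f t).grad (uaction t)) (uaction t - (experts i).action f t) / (2 * (G * D)) := by
  have hloss : ∀ j, uscLoss G D (ustate t) (f t) j =
      (inner ℝ ((f t).grad (uaction t)) ((experts j).action f t - uaction t) + G * D) /
        (2 * G * D) := by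
    intro j
    unfold uscLoss
    rw [usc_expert]
    rfl
  have hzero : ∑ j, uscProb (ustate t) j *
      (inner ℝ ((f t).grad (uaction t)) ((experts j).action f t - uaction t) : ℝ) = 0 := by
    have h1 : ∑ j, uscProb (ustate t) j • ((experts j).action f t - uaction t) = 0 := by
      simp only [smul_sub, Finset.sum_sub_distrib]
      rw [← Finset.sum_smul, usc_sum_prob hK hw, one_smul, ← usc_action_eq, sub_self]
    have h2 := congrArg (fun v => (inner ℝ ((f t).grad (uaction t)) v : ℝ)) h1
    simpa [inner_sum, real_inner_smul_right] using h2
  have hmean : ∑ j, uscProb (ustate t) j * uscLoss G D (ustate t) (f t) j = 1 / 2 := by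
    calc ∑ j, uscProb (ustate t) j * uscLoss G D (ustate t) (f t) j
        = (∑ j, uscProb (ustate t) j *
            (inner ℝ ((f t).grad (uaction t)) ((experts j).action f t - uaction t) : ℝ) +
          (∑ j, uscProb (ustate t) j) * (G * D)) / (2 * G * D) := by
          rw [Finset.sum_mul, ← Finset.sum_add_distrib, Finset.sum_div]
          exact Finset.sum_congr rfl fun j _ => by rw [hloss]; ring
      _ = 1 / 2 := by rw [hzero, usc_sum_prob hK hw]; field_simp; ring
  have hneg : (inner ℝ ((f t).grad (uaction t)) ((experts i).action f t - uaction t) : ℝ) =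
      -inner ℝ ((f t).grad (uaction t)) (uaction t - (experts i).action f t) := by
    rw [← inner_neg_right, neg_sub]
  unfold uscGap
  rw [hmean, hloss, hneg]
  field_simp
  ring

lemma usc_abs_gap_le (hf : IsInstance X G D T f) (hK : 2 ≤ Fintype.card ι) {t : ℕ} (ht : t < T)
    (hw : ∀ i, 0 < (ustate t).w i) (hmem : ∀ i, (experts i).action f t ∈ X) (i : ι) :
    |uscGap G D (ustate t) (f t) i| ≤ 1 / 2 := by
  have hGD : 0 < G * D := mul_pos hf.G_pos hf.D_pos
  have hx := usc_action_mem_of_weight_pos hf.convex hK hw hmem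
  rw [usc_gap_eq hf.G_pos hf.D_pos hK hw, abs_div, abs_of_pos (by positivity : 0 < 2 * (G * D)),
    div_le_iff₀ (by positivity)]
  have := abs_inner_le_mul (hf.grad_le t ht _ hx) (hf.diam_le _ hx _ (hmem i))
  linarith

lemma usc_weight_pos (hf : IsInstance X G D T f) (hK : 2 ≤ Fintype.card ι)
    (hmem : ∀ i, ∀ t < T, (experts i).action f t ∈ X) {t : ℕ} (ht : t ≤ T) (i : ι) :
    0 < (ustate t).w i := by
  induction t generalizing i with
  | zero =>
    have : (0 : ℝ) < Fintype.card ι := by exact_mod_cast (by omega : 0 < Fintype.card ι)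
    exact one_div_pos.2 this
  | succ t ih =>
    have hw := fun j => ih (by omega) j
    have h1 := abs_le.1 (usc_abs_gap_le hf hK (by omega) hw (fun j => hmem j t (by omega)) i)
    have h2 := uscRate_le_half (Fintype.card ι) ((ustate t).sq i)
    have h3 := uscRate_pos hK (usc_sq_nonneg (experts := experts) (G := G) (D := D) (f := f) t i)
    have h4 : 0 < 1 + uscRate (Fintype.card ι) ((ustate t).sq i) *
        uscGap G D (ustate t) (f t) i := by nlinarith
    exact Real.rpow_pos_of_pos (mul_pos (hw i) h4) _

lemma usc_action_mem (hf : IsInstance X G D T f) (hK : 2 ≤ Fintype.card ι)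
    (hmem : ∀ i, ∀ t < T, (experts i).action f t ∈ X) {t : ℕ} (ht : t < T) : uaction t ∈ X :=
  usc_action_mem_of_weight_pos hf.convex hK (usc_weight_pos hf hK hmem ht.le)
    (fun i => hmem i t ht)

/-- The second-order bound of USC against any of its experts. -/
lemma usc_second_order {A : ℝ} (hA : 1 ≤ A) (hf : IsInstance X G D T f) (hT : 2 ≤ T)
    (hK : 2 ≤ Fintype.card ι) (hKA : (Fintype.card ι : ℝ) ≤ A * Real.log (T : ℝ))
    (hmem : ∀ i, ∀ t < T, (experts i).action f t ∈ X) (i : ι) :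
    ∑ t ∈ Finset.range T,
        (inner ℝ ((f t).grad (uaction t)) (uaction t - (experts i).action f t) : ℝ) ≤
      19 * A * √(Real.log (T : ℝ) *
        (G ^ 2 * ∑ t ∈ Finset.range T, ‖uaction t - (experts i).action f t‖ ^ 2)) +
      120 * A * (G * D * Real.log (T : ℝ)) := by
  have hG := hf.G_pos
  have hD := hf.D_pos
  have hGD : 0 < G * D := mul_pos hG hD
  have hlog := half_le_log hT
  set r : ℕ → ι → ℝ := fun t j => uscGap G D (ustate t) (f t) j with hr
  have hgap : ∀ t < T, ∀ j, r t j =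
      inner ℝ ((f t).grad (uaction t)) (uaction t - (experts j).action f t) / (2 * (G * D)) :=
    fun t ht j => usc_gap_eq hG hD hK (usc_weight_pos hf hK hmem ht.le) j
  have hmix : ∀ t < T,
      ∑ j, uscRate (Fintype.card ι) ((ustate t).sq j) * (ustate t).w j * r t j = 0 := by
    intro t ht
    have hw := usc_weight_pos hf hK hmem ht.le
    have hS := usc_sum_rate_pos hK hw
    have h1 : ∑ j, uscProb (ustate t) j * r t j = 0 := by
      simp only [hr, uscGap, mul_sub, Finset.sum_sub_distrib]
      rw [← Finset.sum_mul, usc_sum_prob hK hw, one_mul, sub_self]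
    simp only [uscProb, div_mul_eq_mul_div] at h1
    rw [← Finset.sum_div, div_eq_zero_iff] at h1
    exact h1.resolve_right hS.ne'
  have hreg := adaptMLProd_sum_le (T := T) (r := r) (w := fun t => (ustate t).w)
    (v := fun t => (ustate t).sq) hK (fun _ => rfl) (fun _ _ => rfl) (fun _ => rfl)
    (fun _ _ => rfl) (fun t ht => usc_weight_pos hf hK hmem ht)
    (fun t ht => usc_abs_gap_le hf hK ht (usc_weight_pos hf hK hmem ht.le)
      (fun j => hmem j t ht)) hmix i
  have hreg' := hreg.trans
    (adaptMLProd_bound_le hA hT hK hKA (usc_sq_nonneg T i))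
  have hsq : ∀ t ≤ T, (2 * (G * D)) ^ 2 * (ustate t).sq i ≤
      G ^ 2 * ∑ s ∈ Finset.range t, ‖uaction s - (experts i).action f s‖ ^ 2 := by
    intro t ht
    induction t with
    | zero =>
      have : (ustate 0).sq i = 0 := rfl
      simp [this]
    | succ t ih =>
      have hstep : (ustate (t + 1)).sq i = (ustate t).sq i + r t i ^ 2 := rfl
      have hx := usc_action_mem hf hK hmem (show t < T by omega)
      have h1 : (2 * (G * D)) ^ 2 * r t i ^ 2 ≤
          G ^ 2 * ‖uaction t - (experts i).action f t‖ ^ 2 := by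
        rw [hgap t (by omega), div_pow, mul_div_cancel₀ _ (by positivity), ← mul_pow, ← sq_abs]
        exact pow_le_pow_left₀ (abs_nonneg _) ((abs_real_inner_le_norm _ _).trans
          (mul_le_mul_of_nonneg_right (hf.grad_le t (by omega) _ hx) (norm_nonneg _))) 2
      rw [hstep, mul_add, Finset.sum_range_succ, mul_add]
      linarith [ih (by omega)]
  have hsum : ∑ t ∈ Finset.range T,
      (inner ℝ ((f t).grad (uaction t)) (uaction t - (experts i).action f t) : ℝ) =
      2 * (G * D) * ∑ t ∈ Finset.range T, r t i := by
    rw [Finset.mul_sum]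
    refine Finset.sum_congr rfl fun t ht => ?_
    rw [hgap t (Finset.mem_range.1 ht), mul_div_cancel₀ _ (by positivity)]
  have hroot : 2 * (G * D) * √(Real.log (T : ℝ) * (ustate T).sq i) ≤ √(Real.log (T : ℝ) *
      (G ^ 2 * ∑ t ∈ Finset.range T, ‖uaction t - (experts i).action f t‖ ^ 2)) := by
    have h2 : 2 * (G * D) = √((2 * (G * D)) ^ 2) := (Real.sqrt_sq (by positivity)).symm
    rw [h2, ← Real.sqrt_mul (sq_nonneg _)]
    refine Real.sqrt_le_sqrt ?_
    have := mul_le_mul_of_nonneg_left (hsq T le_rfl) (by linarith : 0 ≤ Real.log (T : ℝ))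
    linarith
  rw [hsum]
  calc 2 * (G * D) * ∑ t ∈ Finset.range T, r t i
      ≤ 2 * (G * D) * (19 * A * √(Real.log (T : ℝ) * (ustate T).sq i) +
          60 * A * Real.log (T : ℝ)) := mul_le_mul_of_nonneg_left hreg' (by positivity)
    _ = 19 * A * (2 * (G * D) * √(Real.log (T : ℝ) * (ustate T).sq i)) +
          120 * A * (G * D * Real.log (T : ℝ)) := by ring
    _ ≤ _ := by gcongr

end

end OCO

theorem mainTheorem5 :
    -- MetaGrad, with effective dimension d
    (∃ C : ℝ, 0 < C ∧
      ∀ (d T k : ℕ) (X : Set (OCO.Vec d)) (x₀ : OCO.Vec d) (G D lam : ℝ) (f : ℕ → OCO.Loss d),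
        2 ≤ T → 0 < lam → x₀ ∈ X → OCO.IsInstance X G D T f →
        OCO.IsContaminated T k (OCO.Loss.IsStronglyConvex X lam) f →
        (∀ t < T, (OCO.metaGrad X x₀ G D T).action f t ∈ X) ∧
        (OCO.metaGrad X x₀ G D T).regret X f T ≤ C * OCO.regretBound G D lam k T (d : ℝ)) ∧
    -- Maler, with effective dimension 1
    (∃ C : ℝ, 0 < C ∧
      ∀ (d T k : ℕ) (X : Set (OCO.Vec d)) (x₀ : OCO.Vec d) (G D lam : ℝ) (f : ℕ → OCO.Loss d),
        2 ≤ T → 0 < lam → x₀ ∈ X → OCO.IsInstance X G D T f →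
        OCO.IsContaminated T k (OCO.Loss.IsStronglyConvex X lam) f →
        (∀ t < T, (OCO.maler X x₀ G D T).action f t ∈ X) ∧
        (OCO.maler X x₀ G D T).regret X f T ≤ C * OCO.regretBound G D lam k T 1) ∧
    -- USC over at most A log T experts, one of which is Maler, with effective dimension 1
    (∀ A : ℝ, ∃ C : ℝ, 0 < C ∧
      ∀ (d T k : ℕ) (X : Set (OCO.Vec d)) (x₀ : OCO.Vec d) (G D lam : ℝ) (f : ℕ → OCO.Loss d)
        (ι : Type) [Fintype ι] (experts : ι → OCO.OnlineAlgorithm d) (i₀ : ι),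
        2 ≤ T → 0 < lam → x₀ ∈ X → OCO.IsInstance X G D T f →
        OCO.IsContaminated T k (OCO.Loss.IsStronglyConvex X lam) f →
        2 ≤ Fintype.card ι → (Fintype.card ι : ℝ) ≤ A * Real.log (T : ℝ) →
        experts i₀ = OCO.maler X x₀ G D T →
        (∀ i, i ≠ i₀ → ∀ t < T, (experts i).action f t ∈ X) →
        (∀ t < T, (OCO.usc experts G D).action f t ∈ X) ∧
        (OCO.usc experts G D).regret X f T ≤ C * OCO.regretBound G D lam k T 1) := by
  refine ⟨⟨9 ^ 2 / 2 + 9 + 80, by norm_num, ?_⟩, ⟨9 ^ 2 / 2 + 9 + 80, by norm_num, ?_⟩, ?_⟩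
  · intro d T k X x₀ G D lam f hT hlam hx₀ hf hcont
    exact ⟨fun t _ => OCO.metaGrad_action_mem hf hx₀ t,
      OCO.OnlineAlgorithm.regret_le ⟨x₀, hx₀⟩
        fun u hu => OCO.metaGrad_sum_sub_le hf hx₀ hT hlam hcont hu⟩
  · intro d T k X x₀ G D lam f hT hlam hx₀ hf hcont
    exact ⟨fun t _ => OCO.maler_action_mem hf hx₀ hT t,
      OCO.OnlineAlgorithm.regret_le ⟨x₀, hx₀⟩
        fun u hu => OCO.maler_sum_sub_le hf hx₀ hT hlam hcont hu⟩
  · intro A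
    have hB : 1 ≤ max A 1 := le_max_right A 1
    refine ⟨((19 * max A 1) ^ 2 / 2 + 19 * max A 1 + 120 * max A 1) + (9 ^ 2 / 2 + 9 + 80),
      by positivity, ?_⟩
    intro d T k X x₀ G D lam f ι _ experts i₀ hT hlam hx₀ hf hcont hK hKA hi₀ hothers
    have hlog := OCO.half_le_log hT
    have hi₀mem : ∀ t < T, (experts i₀).action f t ∈ X := by
      intro t _
      rw [hi₀]
      exact OCO.maler_action_mem hf hx₀ hT t
    have hmem : ∀ i, ∀ t < T, (experts i).action f t ∈ X := by
      intro i
      by_cases h : i = i₀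
      · rw [h]; exact hi₀mem
      · exact hothers i h
    have hKB : (Fintype.card ι : ℝ) ≤ max A 1 * Real.log (T : ℝ) :=
      hKA.trans (mul_le_mul_of_nonneg_right (le_max_left A 1) (by linarith))
    refine ⟨fun t ht => OCO.usc_action_mem hf hK hmem ht,
      OCO.OnlineAlgorithm.regret_le ⟨x₀, hx₀⟩ fun u hu => ?_⟩
    -- The regret against Maler's own, moving, points plus the regret of Maler.
    have h1 := OCO.sum_sub_le_of_second_order hf hlam hcont
      (fun t ht => OCO.usc_action_mem hf hK hmem ht) hi₀mem (by positivity) (by positivity)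
      (by linarith) (OCO.usc_second_order hB hf hT hK hKB hmem i₀)
    have h2 := OCO.maler_sum_sub_le hf hx₀ hT hlam hcont hu
    rw [← hi₀] at h2
    have h3 : OCO.regretBound G D lam k T 1 = (G ^ 2 / lam + G * D) * Real.log (T : ℝ) +
        G * D * √(k * Real.log (T : ℝ)) := by
      simp only [OCO.regretBound, mul_one]
    rw [← h3] at h1
    have h4 := add_le_add h1 h2
    rw [← Finset.sum_add_distrib] at h4
    simpa only [sub_add_sub_cancel, ← add_mul] using h4
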